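/- Consider the linear time-invariant plant $$\dot x = A x + B_u u + B_w w,\qquad z = C_z x + D_u u + D_w w,\qquad y = C_y x + D_{yw} w,$$ with real matrices, $x\in\mathbb R^{N_x}$, $u\in\mathbb R^{N_u}$, $w\in\mathbb R^{N_w}$, $z\in\mathbb R^{N_z}$, $y\in\mathbb R^{N_y}$, and full-order output-feedback controllers $$\dot x_K = A_K x_K + B_K y,\qquad u = C_K x_K + D_K y,\qquad x_K\in\mathbb R^{N_x}.$$ The closed loop has the matrices $$A_{cl}=\begin{bmatrix}A+B_uD_KC_y & B_uC_K\\ B_KC_y & A_K\end{bmatrix},\quad B_{cl}=\begin{bmatrix}B_w+B_uD_KD_{yw}\\ B_KD_{yw}\end{bmatrix},$$ $$C_{cl}=\begin{bmatrix}C_z+D_uD_KC_y & D_uC_K\end{bmatrix},\quad D_{cl}=D_w+D_uD_KD_{yw},\quad \tilde C=\begin{bmatrix}D_KC_y & C_K\end{bmatrix},$$ and the transfer functions $$G_{cl}(s)=C_{cl}(sI-A_{cl})^{-1}B_{cl}+D_{cl},\qquad G_{u_i}(s)=\mathrm{row}_i(\tilde C)(sI-A_{cl})^{-1}B_{cl}+\mathrm{row}_i(D_KD_{yw}).$$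 For stable $G$ let $\|G\|_{\mathcal H_2}=\bigl(\frac1{2\pi}\int_{-\infty}^{\infty}\mathrm{tr}\,(G(i\omega)^*G(i\omega))\,d\omega\bigr)^{1/2}\in[0,\infty]$. Let $\gamma_0>0$ and let $\rho\in\mathbb R^{N_u}$ be a vector of positive weights. **Design problem.** Minimize (i.e. take the infimum of) $\|\Gamma\|_{1,\rho}=\sum_i\rho_i|\gamma_i|$ over $\Gamma=(\gamma_i)\in\mathbb R^{N_u}$ and full-order controllers such that $A_{cl}$ is Hurwitz, $\|G_{cl}\|_{\mathcal H_2}<\gamma_0$ and $\|G_{u_i}\|_{\mathcal H_2}<\sqrt{\gamma_i}$ for $i=1,\dots,N_u$ (for $\gamma_i\le 0$ this last constraint is regarded as violated). **LMI problem.** Write $\mathrm{sym}(S)=S+S^\top$; $S>0$ ($S<0$) means that $S$ is symmetric and positive (negative) definite, and $*$ denotes entries determined by symmetry. Minimize $\|\Gamma\|_{1,\rho}$ over $\Gamma>0$ (entrywise) and matrices $X,Y,\hat A_K,\hat B_K,\hat C_K,\hat D_K,Q$ with $X,Y,Q>0$ subject to $$\begin{bmatrix}\mathrm{sym}(AX+B_u\hat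 C_K) & * & *\\ \hat A_K+(A+B_u\hat D_KC_y)^\top & \mathrm{sym}(YA+\hat B_KC_y) & *\\ (B_w+B_u\hat D_KD_{yw})^\top & (YB_w+\hat B_KD_{yw})^\top & -I\end{bmatrix}<0,$$ $$\begin{bmatrix}X & I & (C_zX+D_u\hat C_K)^\top\\ * & Y & (C_z+D_u\hat D_KC_y)^\top\\ * & * & Q\end{bmatrix}>0,\qquad \mathrm{tr}\,Q<\gamma_0^2,\qquad D_w+D_u\hat D_KD_{yw}=0,$$ $$\begin{bmatrix}\gamma_i & \mathrm{row}_i(\hat C_K) & \mathrm{row}_i(\hat D_KC_y)\\ * & X & I\\ * & * & Y\end{bmatrix}>0\quad(i=1,\dots,N_u),\qquad \hat D_KD_{yw}=0.$$ **Theorem.** The design problem is solved by the LMI problem, in the following sense. 1. $\Gamma$ and a full-order controller $(A_K,B_K,C_K,D_K)$ are feasible for the design problem if and only if there are a symmetric $X_{cl}>0$ and a matrix $Q$ such that, with the partitions $X_{cl}=\begin{bmatrix}Y&N\\N^\top&\star\end{bmatrix}$, $X_{cl}^{-1}=\begin{bmatrix}X&M\\M^\top&\star\end{bmatrix}$ into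 $N_x\times N_x$ blocks and $$\begin{aligned}\hat A_K&=NA_KM^\top+NB_KC_yX+YB_uC_KM^\top+Y(A+B_uD_KC_y)X,\\ \hat B_K&=NB_K+YB_uD_K,\qquad \hat C_K=C_KM^\top+D_KC_yX,\qquad \hat D_K=D_K,\end{aligned}$$ the point $(\Gamma,X,Y,\hat A_K,\hat B_K,\hat C_K,\hat D_K,Q)$ is feasible for the LMI problem. 2. For every feasible point of the LMI problem there are nonsingular $M,N$ with $MN^\top=I-XY$, and for all such $M,N$ the controller $$\begin{aligned}D_K&=\hat D_K,\qquad C_K=(\hat C_K-D_KC_yX)M^{-\top},\qquad B_K=N^{-1}(\hat B_K-YB_uD_K),\\ A_K&=N^{-1}\bigl[\hat A_K-NB_KC_yX-YB_uC_KM^\top-Y(A+B_uD_KC_y)X\bigr]M^{-\top}\end{aligned}$$ is feasible for the design problem with the same $\Gamma$. 3. Every feasible pair of the design problem, consisting of $\Gamma$ and a full-order controller, arises as in 2 from a feasible point of the LMI problem with the same $\Gamma$ and some such $M,N$. 4. The two problems have the same optimal value (infimum, $+\infty$ if infeasible). -/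

import Mathlib

open scoped Matrix ENNReal

noncomputable section

namespace SparseH2

/-- `Sym M = M + Mᵀ` for a real square matrix. -/
def sym {n : Type*} (M : Matrix n n ℝ) : Matrix n n ℝ := M + Mᵀ

/-- `M > 0`: symmetric positive definite. -/
def Pos {n : Type*} (M : Matrix n n ℝ) : Prop := M.PosDef

/-- `M < 0`: symmetric negative definite. -/
def Neg {n : Type*} (M : Matrix n n ℝ) : Prop := (-M).PosDef

/-- The `i`-th row of a matrix, as a one-row matrix. -/
def row {m n : Type*} (M : Matrix m n ℝ) (i : m) : Matrix Unit n ℝ :=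
  Matrix.of fun _ j => M i j

/-- All (complex) eigenvalues of the real matrix `A` have negative real part. -/
def Hurwitz {n : Type*} [Fintype n] [DecidableEq n] (A : Matrix n n ℝ) : Prop :=
  ∀ s ∈ spectrum ℂ (A.map (Complex.ofReal : ℝ → ℂ)), s.re < 0

/-- Transfer function matrix `G(s) = C (sI - A)⁻¹ B + D`. -/
def transfer {n m p : Type*} [Fintype n] [DecidableEq n]
    (A : Matrix n n ℝ) (B : Matrix n m ℝ) (C : Matrix p n ℝ) (D : Matrix p m ℝ) (s : ℂ) :
    Matrix p m ℂ :=
  C.map (Complex.ofReal : ℝ → ℂ) *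
      (s • (1 : Matrix n n ℂ) - A.map (Complex.ofReal : ℝ → ℂ))⁻¹ *
      B.map (Complex.ofReal : ℝ → ℂ) +
    D.map (Complex.ofReal : ℝ → ℂ)

/-- The `H₂` norm `((1 / 2π) ∫ tr (G(iω)ᴴ G(iω)) dω)^(1/2)` of a stable transfer function, with
values in `[0, ∞]`; it is `∞` when the integral diverges (in particular when a rational `G` is
not strictly proper).  It is only used together with stability of the underlying realization. -/
def h2Norm {p m : Type*} [Fintype p] [Fintype m] (G : ℂ → Matrix p m ℂ) : ℝ≥0∞ :=
  (ENNReal.ofReal (1 / (2 * Real.pi)) *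
    ∫⁻ ω : ℝ, ENNReal.ofReal
      (((G ((ω : ℂ) * Complex.I))ᴴ * G ((ω : ℂ) * Complex.I)).trace).re) ^ (1 / 2 : ℝ)

/-- The plant `ẋ = A x + Bu u + Bw w`, `z = Cz x + Du u + Dw w`, `y = Cy x + Dyw w`. -/
structure Plant (nx nu nw nz ny : ℕ) where
  A : Matrix (Fin nx) (Fin nx) ℝ
  Bu : Matrix (Fin nx) (Fin nu) ℝ
  Bw : Matrix (Fin nx) (Fin nw) ℝ
  Cz : Matrix (Fin nz) (Fin nx) ℝ
  Du : Matrix (Fin nz) (Fin nu) ℝ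
  Dw : Matrix (Fin nz) (Fin nw) ℝ
  Cy : Matrix (Fin ny) (Fin nx) ℝ
  Dyw : Matrix (Fin ny) (Fin nw) ℝ

/-- The dynamic output-feedback controller `ẋK = AK xK + BK y`, `u = CK xK + DK y`
of order `nk`. -/
@[ext]
structure Controller (nk nu ny : ℕ) where
  AK : Matrix (Fin nk) (Fin nk) ℝ
  BK : Matrix (Fin nk) (Fin ny) ℝ
  CK : Matrix (Fin nu) (Fin nk) ℝ
  DK : Matrix (Fin nu) (Fin ny) ℝ

section ClosedLoop

variable {nx nu nw nz ny nk : ℕ} (P : Plant nx nu nw nz ny) (K : Controller nk nu ny)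

def Acl : Matrix (Fin nx ⊕ Fin nk) (Fin nx ⊕ Fin nk) ℝ :=
  Matrix.fromBlocks (P.A + P.Bu * K.DK * P.Cy) (P.Bu * K.CK) (K.BK * P.Cy) K.AK

def Bcl : Matrix (Fin nx ⊕ Fin nk) (Fin nw) ℝ :=
  Matrix.fromRows (P.Bw + P.Bu * K.DK * P.Dyw) (K.BK * P.Dyw)

def Ccl : Matrix (Fin nz) (Fin nx ⊕ Fin nk) ℝ :=
  Matrix.fromCols (P.Cz + P.Du * K.DK * P.Cy) (P.Du * K.CK)

def Dcl : Matrix (Fin nz) (Fin nw) ℝ := P.Dw + P.Du * K.DK * P.Dyw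

/-- `C̃ = [DK Cy, CK]`, so that `u = C̃ xcl + DK Dyw w`. -/
def Ctilde : Matrix (Fin nu) (Fin nx ⊕ Fin nk) ℝ := Matrix.fromCols (K.DK * P.Cy) K.CK

/-- Closed-loop transfer function from `w` to `z`. -/
def Gcl : ℂ → Matrix (Fin nz) (Fin nw) ℂ :=
  transfer (Acl P K) (Bcl P K) (Ccl P K) (Dcl P K)

/-- Closed-loop transfer function from `w` to the `i`-th control channel `u_i`. -/
def Gu (i : Fin nu) : ℂ → Matrix Unit (Fin nw) ℂ :=
  transfer (Acl P K) (Bcl P K) (row (Ctilde P K) i) (row (K.DK * P.Dyw) i)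

/-- `(Γ, K)` is feasible for the sparse-actuation design problem: `K` is internally stabilizing,
`‖G_cl‖ < γ₀` and `‖G_{u_i}‖ < √γ_i` for every channel `i`, in the `H₂` norm. -/
def DesignFeasible (γ₀ : ℝ) (Γ : Fin nu → ℝ) : Prop :=
  Hurwitz (Acl P K) ∧
  h2Norm (Gcl P K) < ENNReal.ofReal γ₀ ∧
  ∀ i, h2Norm (Gu P K i) < ENNReal.ofReal (√(Γ i))

end ClosedLoop

/-- Weighted `ℓ₁` norm `ρᵀ |Γ|`. -/
def weightedL1 {nu : ℕ} (ρ Γ : Fin nu → ℝ) : ℝ := ∑ i, ρ i * |Γ i|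

/-- The matrix variables of the LMI problem: `X`, `Y`, the transformed controller matrices
`ÂK, B̂K, ĈK, D̂K`, and `Q`. -/
structure LMIVars (nx nu nz ny : ℕ) where
  X : Matrix (Fin nx) (Fin nx) ℝ
  Y : Matrix (Fin nx) (Fin nx) ℝ
  Ah : Matrix (Fin nx) (Fin nx) ℝ
  Bh : Matrix (Fin nx) (Fin ny) ℝ
  Ch : Matrix (Fin nu) (Fin nx) ℝ
  Dh : Matrix (Fin nu) (Fin ny) ℝ
  Q : Matrix (Fin nz) (Fin nz) ℝ

section LMI

variable {nx nu nw nz ny : ℕ} (P : Plant nx nu nw nz ny) (V : LMIVars nx nu nz ny)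

/-- The Lyapunov matrix (to be negative definite). -/
def lyapMatrix : Matrix ((Fin nx ⊕ Fin nx) ⊕ Fin nw) ((Fin nx ⊕ Fin nx) ⊕ Fin nw) ℝ :=
  Matrix.fromBlocks
    (Matrix.fromBlocks
      (sym (P.A * V.X + P.Bu * V.Ch)) (V.Ah + (P.A + P.Bu * V.Dh * P.Cy)ᵀ)ᵀ
      (V.Ah + (P.A + P.Bu * V.Dh * P.Cy)ᵀ) (sym (V.Y * P.A + V.Bh * P.Cy)))
    (Matrix.fromRows (P.Bw + P.Bu * V.Dh * P.Dyw) (V.Y * P.Bw + V.Bh * P.Dyw))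
    (Matrix.fromCols (P.Bw + P.Bu * V.Dh * P.Dyw)ᵀ (V.Y * P.Bw + V.Bh * P.Dyw)ᵀ)
    (-1)

/-- The performance matrix
`[X, I, (Cz X + Du ĈK)ᵀ; *, Y, (Cz + Du D̂K Cy)ᵀ; *, *, Q]` (to be positive definite). -/
def perfMatrix : Matrix ((Fin nx ⊕ Fin nx) ⊕ Fin nz) ((Fin nx ⊕ Fin nx) ⊕ Fin nz) ℝ :=
  Matrix.fromBlocks
    (Matrix.fromBlocks V.X 1 1 V.Y)
    (Matrix.fromRows (P.Cz * V.X + P.Du * V.Ch)ᵀ (P.Cz + P.Du * V.Dh * P.Cy)ᵀ)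
    (Matrix.fromCols (P.Cz * V.X + P.Du * V.Ch) (P.Cz + P.Du * V.Dh * P.Cy))
    V.Q

/-- The matrix of the `i`-th actuator channel
`[γ, row_i ĈK, row_i (D̂K Cy); *, X, I; *, *, Y]` (to be positive definite). -/
def channelMatrix (γ : ℝ) (i : Fin nu) :
    Matrix (Unit ⊕ (Fin nx ⊕ Fin nx)) (Unit ⊕ (Fin nx ⊕ Fin nx)) ℝ :=
  Matrix.fromBlocks
    (Matrix.of fun _ _ => γ)
    (Matrix.fromCols (row V.Ch i) (row (V.Dh * P.Cy) i))
    (Matrix.fromRows (row V.Ch i)ᵀ (row (V.Dh * P.Cy) i)ᵀ)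
    (Matrix.fromBlocks V.X 1 1 V.Y)

/-- `(Γ, V)` satisfies all constraints of the LMI problem with closed-loop bound `γ₀`. -/
structure LMIFeasible (γ₀ : ℝ) (Γ : Fin nu → ℝ) : Prop where
  Γ_pos : ∀ i, 0 < Γ i
  X_pos : Pos V.X
  Y_pos : Pos V.Y
  Q_pos : Pos V.Q
  lyap : Neg (lyapMatrix P V)
  perf : Pos (perfMatrix P V)
  trace_lt : V.Q.trace < γ₀ ^ 2
  D_cl : P.Dw + P.Du * V.Dh * P.Dyw = 0
  channel : ∀ i, Pos (channelMatrix P V (Γ i) i)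
  D_u : V.Dh * P.Dyw = 0

/-- The change of variables: for a full-order controller `K` and a closed-loop Lyapunov matrix
`Xcl = [Y, N; Nᵀ, ⋆]` with inverse `[X, M; Mᵀ, ⋆]`, the LMI variables `X, Y` and the transformed
controller matrices. -/
def transformVars (K : Controller nx nu ny)
    (Xcl : Matrix (Fin nx ⊕ Fin nx) (Fin nx ⊕ Fin nx) ℝ) (Q : Matrix (Fin nz) (Fin nz) ℝ) :
    LMIVars nx nu nz ny :=
  let Y := Xcl.toBlocks₁₁
  let N := Xcl.toBlocks₁₂
  let X := Xcl⁻¹.toBlocks₁₁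
  let M := Xcl⁻¹.toBlocks₁₂
  { X := X
    Y := Y
    Ah := N * K.AK * Mᵀ + N * K.BK * P.Cy * X + Y * P.Bu * K.CK * Mᵀ +
      Y * (P.A + P.Bu * K.DK * P.Cy) * X
    Bh := N * K.BK + Y * P.Bu * K.DK
    Ch := K.CK * Mᵀ + K.DK * P.Cy * X
    Dh := K.DK
    Q := Q }

/-- The controller constructed from the LMI variables and nonsingular `M, N`
(with `M Nᵀ = I - X Y`). -/
def reconstruct (M N : Matrix (Fin nx) (Fin nx) ℝ) : Controller nx nu ny :=
  let DK := V.Dh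
  let CK := (V.Ch - DK * P.Cy * V.X) * (Mᵀ)⁻¹
  let BK := N⁻¹ * (V.Bh - V.Y * P.Bu * DK)
  { AK := N⁻¹ * (V.Ah - N * BK * P.Cy * V.X - V.Y * P.Bu * CK * Mᵀ -
      V.Y * (P.A + P.Bu * DK * P.Cy) * V.X) * (Mᵀ)⁻¹
    BK := BK
    CK := CK
    DK := DK }

end LMI

section Values

variable {nx nu nw nz ny : ℕ} (P : Plant nx nu nw nz ny) (γ₀ : ℝ) (ρ : Fin nu → ℝ)

/-- Optimal value of the design problem over full-order controllers (`⊤` if infeasible). -/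
def designValue : EReal :=
  sInf {c : EReal | ∃ (Γ : Fin nu → ℝ) (K : Controller nx nu ny),
    DesignFeasible P K γ₀ Γ ∧ c = ((weightedL1 ρ Γ : ℝ) : EReal)}

/-- Optimal value of the LMI problem (`⊤` if infeasible). -/
def lmiValue : EReal :=
  sInf {c : EReal | ∃ (Γ : Fin nu → ℝ) (V : LMIVars nx nu nz ny),
    LMIFeasible P V γ₀ Γ ∧ c = ((weightedL1 ρ Γ : ℝ) : EReal)}

end Values

end SparseH2

end

/-! The `H₂` norm is first reduced to linear algebra. If `A` is Hurwitz and `A P + P Aᵀ = -B Bᵀ`,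
then the squared norm of `C (sI - A)⁻¹ B` is `tr (C P Cᵀ)` (`Hurwitz.h2Norm_transfer`), and a finite
norm forces the feedthrough to vanish (`feedthrough_eq_zero_of_h2Norm_lt_top`). The trace formula is
proved in the frequency domain: on the imaginary axis the Lyapunov equation reads `R S Rᴴ = P Rᴴ + R
P` for the resolvent `R`, so the energy density is the real part of a linear functional of `R`. The
principal value of `∫ R(iω) dω` is `π • 1` (`tendsto_integral_resolvent`). The same limit yields
uniqueness, hence existence, for the Lyapunov equation, and positivity of its solution.

The Gramian lies below every solution of the Lyapunov inequality. Since the norm bounds are strict,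
it can be perturbed to some `W > 0` satisfying that inequality strictly with the trace bounds
intact. Feasibility of a controller is thus equivalent to `ClosedLoopFeasible` for some `W > 0`.

With `Xcl = W⁻¹` and `U = [X, I; Mᵀ, 0]`, the identity `Uᵀ Xcl = [I, 0; Y, N]` turns the congruence
by `U` into the change of variables, and Schur complements give the LMIs
(`lmiFeasible_transformVars_iff`). This needs `M` invertible. From a design it is obtained by a
further small perturbation of `W`; from the LMIs it follows because `[X, I; I, Y] > 0` makes `I - X
Y = M Nᵀ` nonsingular. Conversely, `Xcl` is recovered from `X, Y, M, N` by solving `Xcl U = [I, Y;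
0, Nᵀ]` (`LMIFeasible.exists_transformVars_eq`). -/

namespace SparseH2

open scoped Matrix ENNReal ComplexOrder MatrixOrder

open Filter Topology

local notation "cx(" M ")" => Matrix.map M (Complex.ofReal : ℝ → ℂ)

/-! ### Principal value of the resolvent along the imaginary axis -/

section Resolvent

variable {𝔸 : Type*} [NormedRing 𝔸] [NormedAlgebra ℂ 𝔸]

theorem mem_resolventSet_of_re_nonneg {a : 𝔸} (ha : ∀ s ∈ spectrum ℂ a, s.re < 0) {s : ℂ}
    (hs : 0 ≤ s.re) : s ∈ resolventSet ℂ a := by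
  by_contra h
  exact absurd (ha s h) (not_lt.mpr hs)

/-- The element `-1` is the stable reference with which a general resolvent is compared, its own
resolvent being explicit. -/
theorem re_neg_of_mem_spectrum_neg_one : ∀ s ∈ spectrum ℂ (-1 : 𝔸), s.re < 0 := by
  intro s hs
  by_contra h
  refine hs (spectrum.mem_resolventSet_iff.mpr ?_)
  have h1 : s + 1 ≠ 0 := by
    intro h0
    have := congrArg Complex.re h0
    simp at this
    linarith
  have : algebraMap ℂ 𝔸 s - -1 = algebraMap ℂ 𝔸 (s + 1) := by simp
  rw [this]
  exact (IsUnit.mk0 _ h1).map (algebraMap ℂ 𝔸)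

theorem resolvent_neg_one {s : ℂ} (hs : 0 ≤ s.re) :
    resolvent (-1 : 𝔸) s = (s + 1)⁻¹ • (1 : 𝔸) := by
  have h1 : s + 1 ≠ 0 := by
    intro h0
    have := congrArg Complex.re h0
    simp at this
    linarith
  have : algebraMap ℂ 𝔸 s - -1 = algebraMap ℂ 𝔸 (s + 1) := by simp
  rw [resolvent, this]
  let u : 𝔸ˣ := ⟨algebraMap ℂ 𝔸 (s + 1), (s + 1)⁻¹ • (1 : 𝔸),
    by rw [Algebra.algebraMap_eq_smul_one, smul_mul_smul_comm, mul_inv_cancel₀ h1]; simp,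
    by rw [Algebra.algebraMap_eq_smul_one, smul_mul_smul_comm, inv_mul_cancel₀ h1]; simp⟩
  exact Ring.inverse_unit u

theorem continuous_resolvent_imaginaryAxis [CompleteSpace 𝔸] {a : 𝔸} (ha : ∀ s ∈ spectrum ℂ a, s.re < 0) :
    Continuous fun ω : ℝ => resolvent a ((ω : ℂ) * Complex.I) := by
  rw [continuous_iff_continuousAt]
  intro ω
  have h := (spectrum.hasDerivAt_resolvent_const_left
    (mem_resolventSet_of_re_nonneg ha (s := (ω : ℂ) * Complex.I) (by simp))).continuousAt
  exact ContinuousAt.comp (f := fun ω : ℝ => (ω : ℂ) * Complex.I) h (by fun_prop)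

/-- The integral over the imaginary axis of a function that is holomorphic on the closed right
half plane and `O(|s|⁻²)` vanishes. -/
theorem tendsto_integral_imaginaryAxis_zero {f : ℂ → 𝔸}
    (hf : ∀ s : ℂ, 0 ≤ s.re → DifferentiableAt ℂ f s) {c r : ℝ}
    (hfc : ∀ s : ℂ, 0 ≤ s.re → r ≤ ‖s‖ → ‖f s‖ ≤ c * (‖s‖⁻¹ * ‖s‖⁻¹)) :
    Tendsto (fun T : ℝ => ∫ ω in -T..T, f ((ω : ℂ) * Complex.I)) atTop (𝓝 0) := by
  -- Cauchy's theorem on the rectangle `[0, T] × [-T, T]`: the three sides off the imaginary axis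
  -- have total length `4 T`, and there `‖f‖ ≤ |c| / T²`.
  have hlim : Tendsto (fun T : ℝ => |c| * 4 * T⁻¹) atTop (𝓝 0) := by
    simpa using tendsto_inv_atTop_zero.const_mul (|c| * 4)
  refine squeeze_zero_norm' ?_ hlim
  filter_upwards [eventually_ge_atTop r, eventually_gt_atTop 0] with T hrT hT
  have hb : ∀ s : ℂ, 0 ≤ s.re → T ≤ ‖s‖ → ‖f s‖ ≤ |c| * (T⁻¹ * T⁻¹) := by
    intro s hs hTs
    refine (hfc s hs (hrT.trans hTs)).trans ?_
    have : ‖s‖⁻¹ ≤ T⁻¹ := inv_anti₀ hT hTs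
    gcongr
    exact le_abs_self c
  have key := Complex.integral_boundary_rect_eq_zero_of_differentiableOn f
    (-(T : ℂ) * Complex.I) ((T : ℂ) + (T : ℂ) * Complex.I) (by
      intro s hs
      refine (hf s ?_).differentiableWithinAt
      have := hs.1
      simp [Set.uIcc_of_le hT.le] at this
      exact this.1)
  simp only [Complex.add_re, Complex.mul_re, Complex.neg_re, Complex.ofReal_re, Complex.I_re,
    Complex.ofReal_im, Complex.neg_im, Complex.I_im, Complex.add_im, Complex.mul_im, mul_zero,
    mul_one, sub_zero, add_zero, zero_add, neg_zero, Complex.ofReal_zero] at key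
  set J := ∫ ω in -T..T, f ((ω : ℂ) * Complex.I) with hJ
  have n1 : ‖∫ x : ℝ in (0 : ℝ)..T, f ((x : ℂ) + ((-T : ℝ) : ℂ) * Complex.I)‖
      ≤ |c| * (T⁻¹ * T⁻¹) * |T - 0| := by
    refine intervalIntegral.norm_integral_le_of_norm_le_const fun x hx => hb _ ?_ ?_
    · rw [Set.uIoc_of_le hT.le] at hx
      simpa using hx.1.le
    · refine le_trans ?_ (Complex.abs_im_le_norm _)
      simp [abs_of_pos hT]
  have n2 : ‖∫ x : ℝ in (0 : ℝ)..T, f ((x : ℂ) + (T : ℂ) * Complex.I)‖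
      ≤ |c| * (T⁻¹ * T⁻¹) * |T - 0| := by
    refine intervalIntegral.norm_integral_le_of_norm_le_const fun x hx => hb _ ?_ ?_
    · rw [Set.uIoc_of_le hT.le] at hx
      simpa using hx.1.le
    · refine le_trans ?_ (Complex.abs_im_le_norm _)
      simp [abs_of_pos hT]
  have n3 : ‖∫ y : ℝ in -T..T, f ((T : ℂ) + (y : ℂ) * Complex.I)‖
      ≤ |c| * (T⁻¹ * T⁻¹) * |T - -T| := by
    refine intervalIntegral.norm_integral_le_of_norm_le_const fun x _ => hb _ ?_ ?_
    · simpa using hT.le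
    · refine le_trans ?_ (Complex.abs_re_le_norm _)
      simp [abs_of_pos hT]
  have hIJ : Complex.I • J
      = (∫ x : ℝ in (0 : ℝ)..T, f ((x : ℂ) + ((-T : ℝ) : ℂ) * Complex.I))
        - (∫ x : ℝ in (0 : ℝ)..T, f ((x : ℂ) + (T : ℂ) * Complex.I))
        + Complex.I • ∫ y : ℝ in -T..T, f ((T : ℂ) + (y : ℂ) * Complex.I) := by
    rw [eq_comm, ← sub_eq_zero]
    exact key
  calc ‖J‖ = ‖Complex.I • J‖ := by simp [norm_smul]
    _ ≤ |c| * (T⁻¹ * T⁻¹) * |T - 0| + |c| * (T⁻¹ * T⁻¹) * |T - 0|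
        + |c| * (T⁻¹ * T⁻¹) * |T - -T| := by
      rw [hIJ]
      refine (norm_add_le _ _).trans (add_le_add ((norm_sub_le _ _).trans (add_le_add n1 n2)) ?_)
      simpa [norm_smul] using n3
    _ = |c| * 4 * T⁻¹ := by
      have h2 : T - -T = 2 * T := by ring
      rw [h2, sub_zero, abs_of_pos hT, abs_of_pos (by positivity : (0 : ℝ) < 2 * T)]
      field_simp
      ring

/-- The integrand decays only like `1 / ω`, so symmetric truncation matters: averaging with the
reflection `ω ↦ -ω` leaves `1 / (1 + ω²)`, whose integral is `2 arctan T`. -/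
theorem tendsto_integral_inv_add_one :
    Tendsto (fun T : ℝ => ∫ ω in -T..T, ((ω : ℂ) * Complex.I + 1)⁻¹) atTop (𝓝 (Real.pi : ℂ)) := by
  have h : ∀ T : ℝ, ∫ ω in -T..T, ((ω : ℂ) * Complex.I + 1)⁻¹ = ((2 * Real.arctan T : ℝ) : ℂ) := by
    intro T
    have hne : ∀ ω : ℝ, (ω : ℂ) * Complex.I + 1 ≠ 0 := by
      intro ω h0
      simpa using congrArg Complex.re h0
    have hc : Continuous fun ω : ℝ => ((ω : ℂ) * Complex.I + 1)⁻¹ :=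
      Continuous.inv₀ (by fun_prop) hne
    have hsym : ∫ ω in -T..T, ((ω : ℂ) * Complex.I + 1)⁻¹
        = ∫ ω in -T..T, (-(ω : ℂ) * Complex.I + 1)⁻¹ := by
      have := intervalIntegral.integral_comp_neg (a := -T) (b := T)
        (fun ω : ℝ => ((ω : ℂ) * Complex.I + 1)⁻¹)
      simpa using this.symm
    have hne' : ∀ ω : ℝ, -(ω : ℂ) * Complex.I + 1 ≠ 0 := by
      intro ω h0
      simpa using congrArg Complex.re h0
    have hc' : Continuous fun ω : ℝ => (-(ω : ℂ) * Complex.I + 1)⁻¹ :=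
      Continuous.inv₀ (by fun_prop) hne'
    have hadd : (∫ ω in -T..T, ((ω : ℂ) * Complex.I + 1)⁻¹)
        + (∫ ω in -T..T, (-(ω : ℂ) * Complex.I + 1)⁻¹)
        = ∫ ω in -T..T, ((2 * (1 + ω ^ 2)⁻¹ : ℝ) : ℂ) := by
      rw [← intervalIntegral.integral_add (hc.intervalIntegrable _ _)
        (hc'.intervalIntegrable _ _)]
      refine intervalIntegral.integral_congr fun ω _ => ?_
      have h3 : (1 + (ω : ℂ) ^ 2) = ((ω : ℂ) * Complex.I + 1) * (-(ω : ℂ) * Complex.I + 1) := by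
        ring_nf
        simp
      push_cast
      rw [h3, inv_add_inv (hne ω) (hne' ω), div_eq_mul_inv]
      congr 1
      ring
    rw [intervalIntegral.integral_ofReal, intervalIntegral.integral_const_mul,
      integral_inv_one_add_sq, Real.arctan_neg] at hadd
    rw [← hsym, ← two_mul] at hadd
    have h2 : (2 : ℂ) ≠ 0 := two_ne_zero
    apply mul_left_cancel₀ h2
    rw [hadd]
    push_cast
    ring
  simp_rw [h]
  have h1 : Tendsto (fun T : ℝ => 2 * Real.arctan T) atTop (𝓝 Real.pi) := by
    have := (tendsto_nhds_of_tendsto_nhdsWithin Real.tendsto_arctan_atTop).const_mul 2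
    rwa [mul_div_cancel₀ _ two_ne_zero] at this
  exact (Complex.continuous_ofReal.tendsto _).comp h1

/-- Principal value of the resolvent of a stable element along the imaginary axis. -/
theorem tendsto_integral_resolvent [CompleteSpace 𝔸] {a : 𝔸} (ha : ∀ s ∈ spectrum ℂ a, s.re < 0) :
    Tendsto (fun T : ℝ => ∫ ω in -T..T, resolvent a ((ω : ℂ) * Complex.I)) atTop
      (𝓝 ((Real.pi : ℂ) • (1 : 𝔸))) := by
  have hb := re_neg_of_mem_spectrum_neg_one (𝔸 := 𝔸)
  have hdiff : ∀ s : ℂ, 0 ≤ s.re →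
      DifferentiableAt ℂ (fun s => resolvent a s - resolvent (-1 : 𝔸) s) s := fun s hs =>
    (spectrum.hasDerivAt_resolvent_const_left
      (mem_resolventSet_of_re_nonneg ha hs)).differentiableAt.sub
    (spectrum.hasDerivAt_resolvent_const_left
      (mem_resolventSet_of_re_nonneg hb hs)).differentiableAt
  obtain ⟨c₁, hc₁⟩ := (spectrum.resolvent_isBigO_inv (𝕜 := ℂ) a).bound
  obtain ⟨c₂, hc₂⟩ := (spectrum.resolvent_isBigO_inv (𝕜 := ℂ) (-1 : 𝔸)).bound
  obtain ⟨r, -, hr⟩ := (Filter.hasBasis_cobounded_norm (E := ℂ)).eventually_iff.mp (hc₁.and hc₂)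
  -- By the resolvent identity the difference is a product containing two resolvents, each
  -- `O(|s|⁻¹)`.
  have h0 := tendsto_integral_imaginaryAxis_zero hdiff (c := |c₁| * ‖a - -1‖ * |c₂|) (r := r) (by
    intro s hs hrs
    obtain ⟨h1, h2⟩ := hr hrs
    rw [spectrum.resolvent_sub_resolvent (mem_resolventSet_of_re_nonneg ha hs)
      (mem_resolventSet_of_re_nonneg hb hs)]
    rw [norm_inv] at h1 h2
    have h1' : ‖resolvent a s‖ ≤ |c₁| * ‖s‖⁻¹ := h1.trans (by gcongr; exact le_abs_self _)
    have h2' : ‖resolvent (-1 : 𝔸) s‖ ≤ |c₂| * ‖s‖⁻¹ := h2.trans (by gcongr; exact le_abs_self _)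
    calc ‖resolvent a s * (a - -1) * resolvent (-1 : 𝔸) s‖
        ≤ ‖resolvent a s‖ * ‖a - -1‖ * ‖resolvent (-1 : 𝔸) s‖ := norm_mul₃_le
      _ ≤ (|c₁| * ‖s‖⁻¹) * ‖a - -1‖ * (|c₂| * ‖s‖⁻¹) := by gcongr
      _ = _ := by ring)
  have h1 : Tendsto (fun T : ℝ => (∫ ω in -T..T, ((ω : ℂ) * Complex.I + 1)⁻¹) • (1 : 𝔸)) atTop
      (𝓝 ((Real.pi : ℂ) • (1 : 𝔸))) := tendsto_integral_inv_add_one.smul_const _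
  have h2 := h0.add h1
  rw [zero_add] at h2
  refine h2.congr fun T => ?_
  rw [intervalIntegral.integral_sub
    ((continuous_resolvent_imaginaryAxis ha).intervalIntegrable _ _)
    ((continuous_resolvent_imaginaryAxis hb).intervalIntegrable _ _)]
  have h3 : ∫ ω in -T..T, resolvent (-1 : 𝔸) ((ω : ℂ) * Complex.I)
      = (∫ ω in -T..T, ((ω : ℂ) * Complex.I + 1)⁻¹) • (1 : 𝔸) := by
    rw [← intervalIntegral.integral_smul_const]
    refine intervalIntegral.integral_congr fun ω _ => ?_
    exact resolvent_neg_one (by simp)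
  rw [h3]
  simp

theorem tendsto_integral_re_resolvent [FiniteDimensional ℂ 𝔸] {a : 𝔸}
    (ha : ∀ s ∈ spectrum ℂ a, s.re < 0) (φ : 𝔸 →ₗ[ℂ] ℂ) :
    Tendsto (fun T : ℝ => ∫ ω in -T..T, (φ (resolvent a ((ω : ℂ) * Complex.I))).re) atTop
      (𝓝 (φ ((Real.pi : ℂ) • (1 : 𝔸))).re) := by
  have : CompleteSpace 𝔸 := FiniteDimensional.complete ℂ 𝔸
  let ψ : 𝔸 →L[ℂ] ℂ := LinearMap.toContinuousLinearMap φ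
  have hlim := (Complex.continuous_re.tendsto _).comp
    ((ψ.continuous.tendsto _).comp (tendsto_integral_resolvent ha))
  refine hlim.congr fun T => ?_
  have hc := continuous_resolvent_imaginaryAxis ha
  rw [Function.comp_apply, Function.comp_apply,
    ← ψ.intervalIntegral_comp_comm (hc.intervalIntegrable _ _)]
  exact (Complex.reCLM.intervalIntegral_comp_comm
    ((ψ.continuous.comp hc).intervalIntegrable _ _)).symm

end Resolvent

/-! ### Real matrices viewed as complex ones -/

section Complexification

variable {m n p : Type*}

theorem map_ofReal_mul [Fintype n] (M : Matrix m n ℝ) (N : Matrix n p ℝ) :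
    cx(M * N) = cx(M) * cx(N) := Matrix.map_mul (f := Complex.ofRealHom)

theorem map_ofReal_add (M N : Matrix m n ℝ) : cx(M + N) = cx(M) + cx(N) := by
  ext; simp

theorem map_ofReal_neg (M : Matrix m n ℝ) : cx(-M) = -cx(M) := by
  ext; simp

theorem conjTranspose_map_ofReal (M : Matrix m n ℝ) : (cx(M))ᴴ = cx(Mᵀ) := by
  ext; simp

theorem trace_map_ofReal [Fintype n] (M : Matrix n n ℝ) : (cx(M)).trace = ((M.trace : ℝ) : ℂ) := by
  simp [Matrix.trace]

theorem posSemidef_map_ofReal [Fintype n] [DecidableEq n] {S : Matrix n n ℝ} (hS : S.PosSemidef) :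
    (cx(S)).PosSemidef := by
  obtain ⟨B, rfl⟩ := CStarAlgebra.nonneg_iff_eq_star_mul_self.mp hS.nonneg
  have : cx(star B * B) = (cx(B))ᴴ * cx(B) := by
    rw [map_ofReal_mul, conjTranspose_map_ofReal, Matrix.star_eq_conjTranspose,
      Matrix.conjTranspose_eq_transpose_of_trivial]
  rw [this]
  exact Matrix.posSemidef_conjTranspose_mul_self _

end Complexification

/-! ### Parseval's identity through the Lyapunov equation -/

section Lyapunov

variable {n : Type*} [Fintype n] [DecidableEq n] {A P S : Matrix n n ℝ}

/-- The resolvent of (the complexification of) `A` on the imaginary axis. -/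
noncomputable def imagResolvent (A : Matrix n n ℝ) (ω : ℝ) : Matrix n n ℂ :=
  (((ω : ℂ) * Complex.I) • (1 : Matrix n n ℂ) - cx(A))⁻¹

theorem imagResolvent_eq_resolvent (A : Matrix n n ℝ) (ω : ℝ) :
    imagResolvent A ω = resolvent cx(A) ((ω : ℂ) * Complex.I) := by
  rw [imagResolvent, Matrix.nonsing_inv_eq_ringInverse, resolvent, Algebra.algebraMap_eq_smul_one]

theorem Hurwitz.isUnit_imaginary (hA : Hurwitz A) (ω : ℝ) :
    IsUnit (((ω : ℂ) * Complex.I) • (1 : Matrix n n ℂ) - cx(A)) := by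
  by_contra h
  have : ((ω : ℂ) * Complex.I) ∈ spectrum ℂ cx(A) := fun h' => h (by
    rwa [spectrum.mem_resolventSet_iff, Algebra.algebraMap_eq_smul_one] at h')
  have := hA _ this
  simp at this

theorem Hurwitz.imagResolvent_mul (hA : Hurwitz A) (ω : ℝ) :
    imagResolvent A ω * (((ω : ℂ) * Complex.I) • (1 : Matrix n n ℂ) - cx(A)) = 1 :=
  Matrix.nonsing_inv_mul _ ((Matrix.isUnit_iff_isUnit_det _).mp (hA.isUnit_imaginary ω))

/-- Frequency-domain form of the Lyapunov equation. -/
theorem Hurwitz.imagResolvent_lyapunov (hA : Hurwitz A) (hP : A * P + P * Aᵀ = -S) (ω : ℝ) :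
    imagResolvent A ω * cx(S) * (imagResolvent A ω)ᴴ =
      cx(P) * (imagResolvent A ω)ᴴ + imagResolvent A ω * cx(P) := by
  set R := imagResolvent A ω with hR
  set Z := ((ω : ℂ) * Complex.I) • (1 : Matrix n n ℂ) - cx(A) with hZ
  have hRZ : R * Z = 1 := hA.imagResolvent_mul ω
  have hZR : Zᴴ * Rᴴ = 1 := by rw [← Matrix.conjTranspose_mul, hRZ, Matrix.conjTranspose_one]
  -- The terms `± iω P` cancel, so the Lyapunov equation survives the shift from `-A` to `Z`.
  have hS : cx(S) = Z * cx(P) + cx(P) * Zᴴ := by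
    have hS' : S = -(A * P + P * Aᵀ) := by rw [hP, neg_neg]
    have hZH : Zᴴ = (-((ω : ℂ) * Complex.I)) • (1 : Matrix n n ℂ) - cx(Aᵀ) := by
      rw [hZ, Matrix.conjTranspose_sub, Matrix.conjTranspose_smul, conjTranspose_map_ofReal]
      simp
    rw [hS', map_ofReal_neg, map_ofReal_add, map_ofReal_mul, map_ofReal_mul, hZH, hZ]
    simp only [sub_mul, mul_sub, smul_mul_assoc, Matrix.mul_smul, one_mul, mul_one, neg_smul,
      mul_neg]
    abel
  calc R * cx(S) * Rᴴ = (R * Z) * cx(P) * Rᴴ + R * cx(P) * (Zᴴ * Rᴴ) := by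
        rw [hS]; noncomm_ring
    _ = _ := by rw [hRZ, hZR, one_mul, mul_one]

theorem re_trace_conjTranspose {m : Type*} [Fintype m] (M : Matrix m m ℂ) :
    (Mᴴ.trace).re = M.trace.re := by
  rw [Matrix.trace_conjTranspose]
  simp

/-- Conjugate transposition preserves the real part of a trace and turns the `P Rᴴ` term into one
with `R Pᵀ`, so the density becomes linear in the resolvent `R`. The sum `P + Pᵀ` appears because
symmetry of `P` is not yet available. -/
theorem Hurwitz.re_trace_output {p : Type*} [Fintype p] (hA : Hurwitz A)
    (hP : A * P + P * Aᵀ = -S) (C : Matrix p n ℝ) (ω : ℝ) :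
    ((cx(C) * (imagResolvent A ω * cx(S) * (imagResolvent A ω)ᴴ) * (cx(C))ᴴ).trace).re =
      ((cx(C) * (imagResolvent A ω * cx(P + Pᵀ)) * (cx(C))ᴴ).trace).re := by
  rw [hA.imagResolvent_lyapunov hP, map_ofReal_add, Matrix.mul_add, Matrix.mul_add,
    Matrix.add_mul, Matrix.mul_add, Matrix.add_mul,
    Matrix.trace_add, Matrix.trace_add, Complex.add_re, Complex.add_re,
    ← re_trace_conjTranspose (cx(C) * (cx(P) * (imagResolvent A ω)ᴴ) * (cx(C))ᴴ)]
  simp only [Matrix.conjTranspose_mul, Matrix.conjTranspose_conjTranspose,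
    conjTranspose_map_ofReal P, Matrix.mul_assoc]
  rw [add_comm]

section Analytic

attribute [local instance] Matrix.linftyOpNormedRing Matrix.linftyOpNormedAlgebra

theorem Hurwitz.continuous_imagResolvent (hA : Hurwitz A) : Continuous (imagResolvent A) := by
  have := continuous_resolvent_imaginaryAxis (a := cx(A)) hA
  refine this.congr fun ω => (imagResolvent_eq_resolvent A ω).symm

/-- Truncated form of Parseval's identity for the output energy. -/
theorem Hurwitz.tendsto_integral_output {p : Type*} [Fintype p] (hA : Hurwitz A)
    (hP : A * P + P * Aᵀ = -S) (C : Matrix p n ℝ) :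
    Tendsto (fun T : ℝ => ∫ ω in -T..T,
      ((cx(C) * (imagResolvent A ω * cx(S) * (imagResolvent A ω)ᴴ) * (cx(C))ᴴ).trace).re) atTop
      (𝓝 (2 * Real.pi * (C * P * Cᵀ).trace)) := by
  let φ : Matrix n n ℂ →ₗ[ℂ] ℂ :=
    { toFun := fun M => (cx(C) * (M * cx(P + Pᵀ)) * (cx(C))ᴴ).trace
      map_add' := fun M N => by
        simp [Matrix.add_mul, Matrix.mul_add, Matrix.trace_add]
      map_smul' := fun c M => by simp [Matrix.trace_smul] }
  have hφ : ∀ M, φ M = (cx(C) * (M * cx(P + Pᵀ)) * (cx(C))ᴴ).trace := fun _ => rfl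
  have hlim := tendsto_integral_re_resolvent (a := cx(A)) hA φ
  have hval : (φ ((Real.pi : ℂ) • (1 : Matrix n n ℂ))).re = 2 * Real.pi * (C * P * Cᵀ).trace := by
    rw [hφ, smul_mul_assoc, one_mul, conjTranspose_map_ofReal, Matrix.mul_smul, Matrix.smul_mul,
      Matrix.trace_smul, ← map_ofReal_mul, ← map_ofReal_mul, trace_map_ofReal]
    have : (C * Pᵀ * Cᵀ).trace = (C * P * Cᵀ).trace := by
      rw [← Matrix.trace_transpose]
      simp [Matrix.transpose_mul, Matrix.mul_assoc]
    rw [Matrix.mul_add, Matrix.add_mul, Matrix.trace_add, this]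
    simp
    ring
  rw [hval] at hlim
  refine hlim.congr fun T => ?_
  refine intervalIntegral.integral_congr fun ω _ => ?_
  rw [hA.re_trace_output hP, imagResolvent_eq_resolvent]
  rfl

theorem Hurwitz.continuous_output {p : Type*} [Fintype p] (hA : Hurwitz A)
    (S : Matrix n n ℝ) (C : Matrix p n ℝ) :
    Continuous fun ω : ℝ =>
      ((cx(C) * (imagResolvent A ω * cx(S) * (imagResolvent A ω)ᴴ) * (cx(C))ᴴ).trace).re := by
  have := hA.continuous_imagResolvent
  refine Complex.continuous_re.comp (Continuous.matrix_trace ?_)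
  exact (continuous_const.matrix_mul ((this.matrix_mul continuous_const).matrix_mul
    this.matrix_conjTranspose)).matrix_mul continuous_const

end Analytic

theorem output_nonneg {p : Type*} [Fintype p] (hS : S.PosSemidef)
    (C : Matrix p n ℝ) (R : Matrix n n ℂ) :
    0 ≤ ((cx(C) * (R * cx(S) * Rᴴ) * (cx(C))ᴴ).trace).re := by
  have h := (((posSemidef_map_ofReal hS).mul_mul_conjTranspose_same R).mul_mul_conjTranspose_same
    cx(C)).trace_nonneg
  exact (Complex.le_def.mp h).1

/-- Parseval's identity for the output energy. -/
theorem Hurwitz.lintegral_output {p : Type*} [Fintype p] (hA : Hurwitz A)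
    (hS : S.PosSemidef) (hP : A * P + P * Aᵀ = -S) (C : Matrix p n ℝ) :
    ∫⁻ ω : ℝ, ENNReal.ofReal
      ((cx(C) * (imagResolvent A ω * cx(S) * (imagResolvent A ω)ᴴ) * (cx(C))ᴴ).trace).re =
      ENNReal.ofReal (2 * Real.pi * (C * P * Cᵀ).trace) := by
  have hc := hA.continuous_output S C
  -- For a nonnegative integrand the limit of the integrals over `(-T, T]` is the full integral, so
  -- a principal value suffices.
  refine (MeasureTheory.aecover_Ioc (μ := MeasureTheory.volume) tendsto_neg_atTop_atBot
    tendsto_id).lintegral_eq_of_tendsto _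
    (ENNReal.continuous_ofReal.comp hc).measurable.aemeasurable ?_
  refine (ENNReal.tendsto_ofReal (hA.tendsto_integral_output hP C)).congr' ?_
  filter_upwards [eventually_ge_atTop 0] with T hT
  rw [intervalIntegral.integral_of_le (by linarith),
    MeasureTheory.ofReal_integral_eq_lintegral_ofReal]
  · rfl
  · exact (hc.intervalIntegrable (-T) T).1
  · exact Eventually.of_forall fun ω => output_nonneg hS C _

theorem Hurwitz.trace_output_nonneg {p : Type*} [Fintype p] (hA : Hurwitz A)
    (hS : S.PosSemidef) (hP : A * P + P * Aᵀ = -S) (C : Matrix p n ℝ) :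
    0 ≤ (C * P * Cᵀ).trace := by
  have h : 0 ≤ 2 * Real.pi * (C * P * Cᵀ).trace := by
    refine ge_of_tendsto (hA.tendsto_integral_output hP C) ?_
    filter_upwards [eventually_ge_atTop 0] with T hT
    exact intervalIntegral.integral_nonneg (by linarith) fun ω _ => output_nonneg hS C _
  have := Real.pi_pos
  by_contra hneg
  nlinarith

end Lyapunov

/-! ### Solvability of the Lyapunov equation, and positivity -/

section LyapunovEquation

variable {n : Type*} [Fintype n] [DecidableEq n] {A P S W : Matrix n n ℝ}

attribute [local instance] Matrix.linftyOpNormedRing Matrix.linftyOpNormedAlgebra in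
theorem Hurwitz.lyapunov_injective (hA : Hurwitz A) (hP : A * P + P * Aᵀ = 0) : P = 0 := by
  have hR : ∀ ω, cx(P) * (imagResolvent A ω)ᴴ + imagResolvent A ω * cx(P) = 0 := by
    intro ω
    rw [← hA.imagResolvent_lyapunov (S := 0) (by rw [hP, neg_zero]) ω]
    have : cx((0 : Matrix n n ℝ)) = 0 := by ext; simp
    rw [this]
    simp
  ext i j
  -- The entry of `P Rᴴ` is conjugate-linear in `R`; the second summand is linear and has the same
  -- real part. Hence `Re φ` vanishes on the resolvent, while `φ(π • 1) = 2π P i j`.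
  let φ : Matrix n n ℂ →ₗ[ℂ] ℂ :=
    { toFun := fun M => (M * cx(P)) i j + (M * cx(Pᵀ)) j i
      map_add' := fun M N => by
        simp only [Matrix.add_mul, Matrix.add_apply]
        ring
      map_smul' := fun c M => by
        simp only [Matrix.smul_mul, Matrix.smul_apply, RingHom.id_apply, smul_eq_mul]
        ring }
  have hφ : ∀ M, φ M = (M * cx(P)) i j + (M * cx(Pᵀ)) j i := fun _ => rfl
  have hlim := tendsto_integral_re_resolvent (a := cx(A)) hA φ
  have hzero : ∀ ω : ℝ, (φ (resolvent cx(A) ((ω : ℂ) * Complex.I))).re = 0 := by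
    intro ω
    rw [hφ, ← imagResolvent_eq_resolvent]
    have h1 := congrArg Complex.re (congrFun (congrFun (hR ω) i) j)
    have h2 : ((imagResolvent A ω * cx(Pᵀ)) j i).re = ((cx(P) * (imagResolvent A ω)ᴴ) i j).re := by
      rw [← conjTranspose_map_ofReal, ← Matrix.conjTranspose_conjTranspose (imagResolvent A ω),
        ← Matrix.conjTranspose_mul, Matrix.conjTranspose_apply, Matrix.conjTranspose_conjTranspose]
      simp
    rw [Matrix.add_apply, Complex.add_re] at h1
    rw [Complex.add_re, h2, add_comm]
    exact h1
  simp only [hzero, intervalIntegral.integral_zero] at hlim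
  have h0 := tendsto_nhds_unique hlim tendsto_const_nhds
  rw [hφ] at h0
  simp at h0
  have := Real.pi_ne_zero
  have h3 : Real.pi * P i j + Real.pi * P i j = 0 := by simpa using h0
  have h4 : Real.pi * P i j = 0 := by linarith
  simpa [this] using h4

/-- An injective endomorphism of a finite-dimensional space is surjective. -/
theorem Hurwitz.exists_lyapunov (hA : Hurwitz A) (S : Matrix n n ℝ) :
    ∃ P, A * P + P * Aᵀ = -S := by
  let L : Matrix n n ℝ →ₗ[ℝ] Matrix n n ℝ :=
    { toFun := fun P => A * P + P * Aᵀ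
      map_add' := fun M N => by
        rw [Matrix.mul_add, Matrix.add_mul]
        abel
      map_smul' := fun c M => by simp }
  have hinj : Function.Injective L := by
    rw [injective_iff_map_eq_zero]
    exact fun M hM => hA.lyapunov_injective hM
  exact (LinearMap.injective_iff_surjective.mp hinj) (-S)

theorem Hurwitz.lyapunov_symm (hA : Hurwitz A) (hS : Sᵀ = S) (hP : A * P + P * Aᵀ = -S) :
    Pᵀ = P := by
  rw [← sub_eq_zero]
  apply hA.lyapunov_injective
  have h : A * Pᵀ + Pᵀ * Aᵀ = -S := by
    have := congrArg Matrix.transpose hP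
    rw [Matrix.transpose_add, Matrix.transpose_mul, Matrix.transpose_mul, Matrix.transpose_neg, hS,
      Matrix.transpose_transpose, add_comm] at this
    exact this
  rw [Matrix.mul_sub, Matrix.sub_mul, sub_add_sub_comm, h, hP, sub_self]

/-- The quadratic form of `P` at `x` is the output energy for the one-row output matrix `xᵀ`. -/
theorem Hurwitz.lyapunov_posSemidef (hA : Hurwitz A) (hS : S.PosSemidef)
    (hP : A * P + P * Aᵀ = -S) : P.PosSemidef := by
  refine Matrix.PosSemidef.of_dotProduct_mulVec_nonneg ?_ fun x => ?_
  · rw [Matrix.IsHermitian, Matrix.conjTranspose_eq_transpose_of_trivial]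
    refine hA.lyapunov_symm ?_ hP
    rw [← Matrix.conjTranspose_eq_transpose_of_trivial, hS.isHermitian.eq]
  · have h := hA.trace_output_nonneg hS hP (Matrix.replicateRow Unit x)
    rw [← Matrix.replicateRow_vecMul, Matrix.transpose_replicateRow] at h
    simpa [Matrix.trace, Matrix.dotProduct_mulVec] using h

/-- A null vector of the form of `P` lies in the kernel of `P`, and the equation then makes it a
null vector of `S`. -/
theorem Hurwitz.lyapunov_posDef (hA : Hurwitz A) (hS : S.PosDef)
    (hP : A * P + P * Aᵀ = -S) : P.PosDef := by
  have hpsd := hA.lyapunov_posSemidef hS.posSemidef hP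
  refine Matrix.PosDef.of_dotProduct_mulVec_pos hpsd.isHermitian fun x hx => ?_
  refine lt_of_le_of_ne (hpsd.dotProduct_mulVec_nonneg x) fun h0 => ?_
  have hPx : P *ᵥ x = 0 := (hpsd.dotProduct_mulVec_zero_iff x).mp h0.symm
  have hxP : star x ᵥ* P = 0 := by
    have := congrArg star hPx
    rwa [Matrix.star_mulVec, hpsd.isHermitian.eq, star_zero] at this
  have hpos := hS.dotProduct_mulVec_pos hx
  have hS' : S = -(A * P + P * Aᵀ) := by rw [hP, neg_neg]
  rw [hS', Matrix.neg_mulVec, Matrix.add_mulVec, ← Matrix.mulVec_mulVec, hPx,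
    Matrix.mulVec_zero, zero_add, dotProduct_neg, Matrix.dotProduct_mulVec,
    ← Matrix.vecMul_vecMul, hxP, Matrix.zero_vecMul, zero_dotProduct, neg_zero] at hpos
  exact lt_irrefl _ hpos

theorem posDef_map_ofReal (hS : S.PosDef) : (cx(S)).PosDef := by
  rw [(posSemidef_map_ofReal hS.posSemidef).posDef_iff_isUnit]
  exact hS.isUnit.map (Complex.ofRealHom.mapMatrix)

/-- Lyapunov's stability criterion. -/
theorem hurwitz_of_lyapunov (hW : W.PosDef) (h : (-(A * W + W * Aᵀ)).PosDef) : Hurwitz A := by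
  intro s hs
  have hdet : ((s • (1 : Matrix n n ℂ)) - cx(A)).det = 0 := by
    by_contra hne
    refine hs ?_
    rw [spectrum.mem_resolventSet_iff, Algebra.algebraMap_eq_smul_one,
      Matrix.isUnit_iff_isUnit_det]
    exact IsUnit.mk0 _ hne
  -- A left eigenvector fits `A W + W Aᵀ`: evaluating the form there gives `2 Re s` times the
  -- positive value of `W`.
  obtain ⟨v, hv0, hv⟩ := Matrix.exists_vecMul_eq_zero_iff.mpr hdet
  have hvA : v ᵥ* cx(A) = s • v := by
    rw [Matrix.vecMul_sub, Matrix.vecMul_smul, Matrix.vecMul_one, sub_eq_zero] at hv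
    exact hv.symm
  have hAv : cx(Aᵀ) *ᵥ star v = star s • star v := by
    rw [← conjTranspose_map_ofReal, ← Matrix.star_vecMul, hvA, star_smul]
  have hv0' : star v ≠ 0 := by simpa using hv0
  have h1 := (posDef_map_ofReal hW).dotProduct_mulVec_pos hv0'
  have h2 := (posDef_map_ofReal h).dotProduct_mulVec_pos hv0'
  rw [star_star] at h1 h2
  have h3 : v ⬝ᵥ cx(-(A * W + W * Aᵀ)) *ᵥ star v
      = -((s + star s) * (v ⬝ᵥ cx(W) *ᵥ star v)) := by
    rw [map_ofReal_neg, map_ofReal_add, map_ofReal_mul, map_ofReal_mul, Matrix.neg_mulVec,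
      Matrix.add_mulVec, ← Matrix.mulVec_mulVec, ← Matrix.mulVec_mulVec, hAv, dotProduct_neg,
      dotProduct_add, Matrix.dotProduct_mulVec v cx(A), hvA, smul_dotProduct, Matrix.mulVec_smul,
      dotProduct_smul, smul_eq_mul, smul_eq_mul, add_mul]
  rw [h3] at h2
  set q := v ⬝ᵥ cx(W) *ᵥ star v
  have h1r := (Complex.lt_def.mp h1)
  have h2r := (Complex.lt_def.mp h2).1
  simp only [Complex.zero_re, Complex.zero_im] at h1r h2r
  rw [Complex.neg_re, Complex.mul_re, ← h1r.2] at h2r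
  simp at h2r
  nlinarith [h1r.1]

end LyapunovEquation

/-! ### The `H₂` norm: Gramian formula, strict properness, upper bounds -/

section H2Norm

variable {n m p : Type*} [Fintype n] [DecidableEq n]
  {A P : Matrix n n ℝ} {B : Matrix n m ℝ} {C : Matrix p n ℝ} {D : Matrix p m ℝ}

theorem transfer_imaginary (ω : ℝ) : transfer A B C D ((ω : ℂ) * Complex.I) =
    cx(C) * imagResolvent A ω * cx(B) + cx(D) := rfl

attribute [local instance] Matrix.linftyOpNormedRing Matrix.linftyOpNormedAlgebra in
-- The resolvent vanishes at infinity, so only the feedthrough survives; if it is nonzero, the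
-- energy density stays bounded below near infinity and the norm is infinite.
theorem tendsto_transfer_imaginary :
    Tendsto (fun ω : ℝ => transfer A B C D ((ω : ℂ) * Complex.I)) atTop (𝓝 cx(D)) := by
  have h1 : Tendsto (fun ω : ℝ => (ω : ℂ) * Complex.I) atTop (Bornology.cobounded ℂ) := by
    rw [← tendsto_norm_atTop_iff_cobounded]
    simpa using tendsto_abs_atTop_atTop
  have h2 : Tendsto (imagResolvent A) atTop (𝓝 0) :=
    ((spectrum.resolvent_tendsto_cobounded (𝕜 := ℂ) cx(A)).comp h1).congr
      fun ω => (imagResolvent_eq_resolvent A ω).symm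
  have h3 : Continuous fun R : Matrix n n ℂ => cx(C) * R * cx(B) + cx(D) :=
    ((continuous_const.matrix_mul continuous_id).matrix_mul continuous_const).add continuous_const
  have h4 := (h3.tendsto 0).comp h2
  simp only [Matrix.mul_zero, Matrix.zero_mul, zero_add] at h4
  exact h4

variable [Fintype m] [Fintype p]

/-- The `H₂` norm of a stable strictly proper system in terms of its controllability Gramian. -/
theorem Hurwitz.h2Norm_transfer (hA : Hurwitz A) (hP : A * P + P * Aᵀ = -(B * Bᵀ)) :
    h2Norm (transfer A B C (0 : Matrix p m ℝ)) = ENNReal.ofReal (√((C * P * Cᵀ).trace)) := by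
  have hS : (B * Bᵀ).PosSemidef := by
    simpa using Matrix.posSemidef_self_mul_conjTranspose B
  have hint : ∀ ω : ℝ, ((transfer A B C (0 : Matrix p m ℝ) ((ω : ℂ) * Complex.I))ᴴ *
      transfer A B C (0 : Matrix p m ℝ) ((ω : ℂ) * Complex.I)).trace =
      (cx(C) * (imagResolvent A ω * cx(B * Bᵀ) * (imagResolvent A ω)ᴴ) * (cx(C))ᴴ).trace := by
    intro ω
    have h0 : cx((0 : Matrix p m ℝ)) = 0 := by ext; simp
    rw [transfer_imaginary, h0, add_zero, Matrix.trace_mul_comm, map_ofReal_mul,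
      ← conjTranspose_map_ofReal]
    simp only [Matrix.conjTranspose_mul, Matrix.mul_assoc]
  have hpi := Real.pi_pos
  have htr := hA.trace_output_nonneg hS hP C
  unfold h2Norm
  simp_rw [hint]
  rw [hA.lintegral_output hS hP C, ← ENNReal.ofReal_mul (by positivity),
    ENNReal.ofReal_rpow_of_nonneg (by positivity) (by norm_num), Real.sqrt_eq_rpow]
  congr 2
  field_simp

theorem le_trace_conjTranspose_mul_self (G : Matrix p m ℂ) (i : p) (j : m) :
    ‖G i j‖ ^ 2 ≤ ((Gᴴ * G).trace).re := by
  have h : ((Gᴴ * G).trace).re = ∑ b, ∑ a, ‖G a b‖ ^ 2 := by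
    simp [Matrix.trace, Matrix.mul_apply, Complex.sq_norm, Complex.normSq_apply]
  rw [h]
  calc ‖G i j‖ ^ 2 ≤ ∑ a, ‖G a j‖ ^ 2 :=
        Finset.single_le_sum (f := fun a => ‖G a j‖ ^ 2) (fun _ _ => by positivity)
          (Finset.mem_univ i)
    _ ≤ _ := Finset.single_le_sum (f := fun b => ∑ a, ‖G a b‖ ^ 2)
          (fun _ _ => by positivity) (Finset.mem_univ j)

/-- A system with finite `H₂` norm is strictly proper. -/
theorem feedthrough_eq_zero_of_h2Norm_lt_top (h : h2Norm (transfer A B C D) < ⊤) : D = 0 := by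
  by_contra hD
  obtain ⟨i, j, hij⟩ : ∃ i j, D i j ≠ 0 := by
    by_contra hcon
    push Not at hcon
    exact hD (by ext i j; simpa using hcon i j)
  have hlim : Tendsto (fun ω : ℝ => ‖transfer A B C D ((ω : ℂ) * Complex.I) i j‖ ^ 2) atTop
      (𝓝 (‖(D i j : ℂ)‖ ^ 2)) := by
    have := (tendsto_pi_nhds.mp (tendsto_pi_nhds.mp
      (tendsto_transfer_imaginary (A := A) (B := B) (C := C) (D := D)) i) j)
    exact (this.norm).pow 2
  have hpos : 0 < ‖(D i j : ℂ)‖ ^ 2 := by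
    have : (D i j : ℂ) ≠ 0 := by exact_mod_cast hij
    positivity
  obtain ⟨c, hc0, hc⟩ := exists_between hpos
  obtain ⟨T, hT⟩ := (eventually_atTop.mp (hlim.eventually (lt_mem_nhds hc)))
  have htop : ∫⁻ ω : ℝ, ENNReal.ofReal (((transfer A B C D ((ω : ℂ) * Complex.I))ᴴ *
      transfer A B C D ((ω : ℂ) * Complex.I)).trace).re = ⊤ := by
    rw [eq_top_iff]
    calc (⊤ : ℝ≥0∞) = ENNReal.ofReal c * MeasureTheory.volume (Set.Ici T) := by
          rw [Real.volume_Ici, ENNReal.mul_top (by simpa using hc0)]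
      _ = ∫⁻ _ in Set.Ici T, ENNReal.ofReal c := by rw [MeasureTheory.setLIntegral_const]
      _ ≤ ∫⁻ ω in Set.Ici T, ENNReal.ofReal (((transfer A B C D ((ω : ℂ) * Complex.I))ᴴ *
            transfer A B C D ((ω : ℂ) * Complex.I)).trace).re := by
          refine MeasureTheory.setLIntegral_mono' measurableSet_Ici fun ω hω => ?_
          exact ENNReal.ofReal_le_ofReal
            ((hT ω hω).le.trans (le_trace_conjTranspose_mul_self _ i j))
      _ ≤ _ := MeasureTheory.setLIntegral_le_lintegral _ _
  have hpi := Real.pi_pos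
  unfold h2Norm at h
  rw [htop, ENNReal.mul_top (by simp; positivity), ENNReal.top_rpow_of_pos (by norm_num)] at h
  exact lt_irrefl _ h

omit [DecidableEq n] [Fintype m] in
theorem trace_conj_mono {M N : Matrix n n ℝ} (h : (N - M).PosSemidef) (C : Matrix p n ℝ) :
    (C * M * Cᵀ).trace ≤ (C * N * Cᵀ).trace := by
  have := (h.mul_mul_conjTranspose_same C).trace_nonneg
  rw [Matrix.mul_sub, Matrix.sub_mul, Matrix.trace_sub,
    Matrix.conjTranspose_eq_transpose_of_trivial] at this
  linarith

/-- A Lyapunov inequality bounds the `H₂` norm. -/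
theorem Hurwitz.h2Norm_transfer_le (hA : Hurwitz A)
    (hP : (-(A * P + P * Aᵀ + B * Bᵀ)).PosSemidef) :
    h2Norm (transfer A B C (0 : Matrix p m ℝ)) ≤ ENNReal.ofReal (√((C * P * Cᵀ).trace)) := by
  obtain ⟨P₀, hP₀⟩ := hA.exists_lyapunov (B * Bᵀ)
  rw [hA.h2Norm_transfer hP₀]
  refine ENNReal.ofReal_le_ofReal (Real.sqrt_le_sqrt (trace_conj_mono ?_ C))
  -- The difference `P - P₀` solves a Lyapunov equation whose source is the semidefinite slack of
  -- the inequality.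
  refine hA.lyapunov_posSemidef hP ?_
  rw [neg_neg, Matrix.mul_sub, Matrix.sub_mul, sub_add_sub_comm, hP₀]
  abel

end H2Norm

/-! ### Schur complements and perturbation of definite matrices -/

section PosDef

variable {m n p : Type*} [Fintype m] [DecidableEq m] [Fintype n] [DecidableEq n]

/-- This splitting upgrades the semidefinite Schur complement criterion to the definite one, since
invertibility also passes to the Schur complement. -/
theorem posDef_iff_posSemidef_and_isUnit {M : Matrix n n ℝ} :
    M.PosDef ↔ M.PosSemidef ∧ IsUnit M :=
  ⟨fun h => ⟨h.posSemidef, h.isUnit⟩, fun h => h.1.posDef_iff_isUnit.mpr h.2⟩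

theorem posDef_fromBlocks_iff₁₁ {A : Matrix m m ℝ} (B : Matrix m n ℝ) (D : Matrix n n ℝ)
    (hA : A.PosDef) : (Matrix.fromBlocks A B Bᵀ D).PosDef ↔ (D - Bᵀ * A⁻¹ * B).PosDef := by
  let _ := hA.isUnit.invertible
  have h := Matrix.PosDef.fromBlocks₁₁ B D hA
  rw [Matrix.conjTranspose_eq_transpose_of_trivial] at h
  rw [posDef_iff_posSemidef_and_isUnit, posDef_iff_posSemidef_and_isUnit, h,
    Matrix.isUnit_fromBlocks_iff_of_invertible₁₁, Matrix.invOf_eq_nonsing_inv]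

theorem posDef_fromBlocks_iff₂₂ (A : Matrix m m ℝ) (B : Matrix m n ℝ) {D : Matrix n n ℝ}
    (hD : D.PosDef) : (Matrix.fromBlocks A B Bᵀ D).PosDef ↔ (A - B * D⁻¹ * Bᵀ).PosDef := by
  let _ := hD.isUnit.invertible
  have h := Matrix.PosDef.fromBlocks₂₂ A B hD
  rw [Matrix.conjTranspose_eq_transpose_of_trivial] at h
  rw [posDef_iff_posSemidef_and_isUnit, posDef_iff_posSemidef_and_isUnit, h,
    Matrix.isUnit_fromBlocks_iff_of_invertible₂₂, Matrix.invOf_eq_nonsing_inv]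

theorem posDef_congruence_iff {U M : Matrix n n ℝ} (hU : IsUnit U) :
    (Uᵀ * M * U).PosDef ↔ M.PosDef := by
  have := Matrix.IsUnit.posDef_star_left_conjugate_iff (x := M) hU
  rwa [Matrix.star_eq_conjTranspose, Matrix.conjTranspose_eq_transpose_of_trivial] at this

theorem posDef_unit_iff {M : Matrix Unit Unit ℝ} : M.PosDef ↔ 0 < M.trace := by
  have : M = Matrix.diagonal fun _ => M () () := by ext; simp
  rw [this, Matrix.posDef_diagonal_iff]
  simp

omit [DecidableEq n] in
theorem abs_quadraticForm_le (K : Matrix n n ℝ) (x : n → ℝ) :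
    |x ⬝ᵥ K *ᵥ x| ≤ (∑ i, ∑ j, |K i j|) * (x ⬝ᵥ x) := by
  have hx : ∀ i, x i * x i ≤ x ⬝ᵥ x := fun i =>
    Finset.single_le_sum (f := fun i => x i * x i) (fun i _ => mul_self_nonneg _)
      (Finset.mem_univ i)
  have hij : ∀ i j, |x i * x j| ≤ x ⬝ᵥ x := by
    intro i j
    rw [abs_le]
    constructor <;> nlinarith [hx i, hx j, sq_nonneg (x i + x j), sq_nonneg (x i - x j)]
  have hsum : x ⬝ᵥ K *ᵥ x = ∑ i, ∑ j, K i j * (x i * x j) := by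
    simp only [dotProduct, Matrix.mulVec, Finset.mul_sum]
    exact Finset.sum_congr rfl fun i _ => Finset.sum_congr rfl fun j _ => by ring
  rw [hsum, Finset.sum_mul]
  refine (Finset.abs_sum_le_sum_abs _ _).trans (Finset.sum_le_sum fun i _ => ?_)
  rw [Finset.sum_mul]
  refine (Finset.abs_sum_le_sum_abs _ _).trans (Finset.sum_le_sum fun j _ => ?_)
  rw [abs_mul]
  exact mul_le_mul_of_nonneg_left (hij i j) (abs_nonneg _)

theorem eventually_posDef_one_add_smul {K : Matrix n n ℝ} (hK : Kᵀ = K) :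
    ∀ᶠ t : ℝ in 𝓝 0, (1 + t • K).PosDef := by
  set k := ∑ i, ∑ j, |K i j|
  have hlim : Tendsto (fun t : ℝ => |t| * k) (𝓝 0) (𝓝 0) := by
    have : Continuous fun t : ℝ => |t| * k := by fun_prop
    simpa using this.tendsto 0
  filter_upwards [hlim.eventually (gt_mem_nhds one_pos)] with t ht
  refine Matrix.PosDef.of_dotProduct_mulVec_pos ?_ fun x hx => ?_
  · rw [Matrix.IsHermitian, Matrix.conjTranspose_eq_transpose_of_trivial]
    simp [hK]
  · have hxx : 0 < x ⬝ᵥ x := by simpa using Matrix.dotProduct_star_self_pos_iff.mpr hx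
    rw [star_trivial, Matrix.add_mulVec, Matrix.one_mulVec, dotProduct_add, Matrix.smul_mulVec,
      dotProduct_smul, smul_eq_mul]
    have h1 := abs_quadraticForm_le K x
    have h2 : |t * (x ⬝ᵥ K *ᵥ x)| ≤ |t| * k * (x ⬝ᵥ x) := by
      rw [abs_mul, mul_assoc]
      exact mul_le_mul_of_nonneg_left h1 (abs_nonneg _)
    have h3 := (abs_le.mp h2).1
    nlinarith

/-- Positive definiteness is stable under small symmetric perturbations. -/
theorem eventually_posDef_add_smul {S H : Matrix n n ℝ} (hS : S.PosDef) (hH : Hᵀ = H) :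
    ∀ᶠ t : ℝ in 𝓝 0, (S + t • H).PosDef := by
  obtain ⟨B, hB, rfl⟩ := CStarAlgebra.isStrictlyPositive_iff_eq_star_mul_self.mp
    hS.isStrictlyPositive
  have hBdet := (Matrix.isUnit_iff_isUnit_det _).mp hB
  have hBT : Bᵀ * (B⁻¹)ᵀ = 1 := by
    rw [← Matrix.transpose_mul, Matrix.nonsing_inv_mul _ hBdet, Matrix.transpose_one]
  filter_upwards [eventually_posDef_one_add_smul (K := (B⁻¹)ᵀ * H * B⁻¹)
    (by simp [hH, Matrix.mul_assoc])] with t ht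
  have := (posDef_congruence_iff hB).mpr ht
  have heq : Bᵀ * (1 + t • ((B⁻¹)ᵀ * H * B⁻¹)) * B = star B * B + t • H := by
    have : Bᵀ * ((B⁻¹)ᵀ * H * B⁻¹) * B = (Bᵀ * (B⁻¹)ᵀ) * H * (B⁻¹ * B) := by
      simp only [Matrix.mul_assoc]
    rw [Matrix.mul_add, Matrix.add_mul, Matrix.mul_one, Matrix.mul_smul, Matrix.smul_mul, this,
      hBT, Matrix.nonsing_inv_mul _ hBdet, Matrix.one_mul, Matrix.mul_one,
      Matrix.star_eq_conjTranspose, Matrix.conjTranspose_eq_transpose_of_trivial]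
  rwa [heq] at this

/-- As a function of `t` the determinant is the characteristic polynomial of `-M`, which has
finitely many roots; `0` itself may be one of them. -/
theorem eventually_isUnit_add_smul_one (M : Matrix n n ℝ) :
    ∀ᶠ t : ℝ in 𝓝[≠] 0, IsUnit (M + t • (1 : Matrix n n ℝ)) := by
  have hfin : {t : ℝ | (-M).charpoly.IsRoot t}.Finite :=
    Polynomial.finite_setOfPred_isRoot (Matrix.charpoly_monic _).ne_zero
  have h : ∀ᶠ t : ℝ in 𝓝[≠] 0, t ∉ {t : ℝ | (-M).charpoly.IsRoot t} := by
    have := (hfin.subset Set.sdiff_subset : ({t : ℝ | (-M).charpoly.IsRoot t} \ {0}).Finite)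
    have h1 := this.isClosed.isOpen_compl.mem_nhds (x := (0 : ℝ)) (by simp)
    filter_upwards [mem_nhdsWithin_of_mem_nhds h1, self_mem_nhdsWithin] with t ht ht0 hr
    exact ht ⟨hr, ht0⟩
  filter_upwards [h] with t ht
  rw [Matrix.isUnit_iff_isUnit_det, isUnit_iff_ne_zero]
  intro hdet
  refine ht ?_
  change (-M).charpoly.eval t = 0
  rw [Matrix.eval_charpoly, ← hdet, sub_neg_eq_add, add_comm, Matrix.scalar_apply,
    ← Matrix.smul_one_eq_diagonal]

end PosDef

/-! ### Congruence and Schur complement for the three kinds of LMI -/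

section Congruence

variable {m n p : Type*} [Fintype m] [DecidableEq m] [Fintype n] [DecidableEq n]
  [Fintype p] [DecidableEq p] {𝒳 U : Matrix n n ℝ}

/-- The Lyapunov inequality of a closed loop, transformed by a congruence. -/
theorem neg_lyapunovBlock_iff (h𝒳 : 𝒳.PosDef) (hU : IsUnit U) (A : Matrix n n ℝ)
    (B : Matrix n m ℝ) :
    Neg (Matrix.fromBlocks (sym (Uᵀ * 𝒳 * A * U)) (Uᵀ * 𝒳 * B) (Uᵀ * 𝒳 * B)ᵀ (-1)) ↔
      (-(A * 𝒳⁻¹ + 𝒳⁻¹ * Aᵀ + B * Bᵀ)).PosDef := by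
  have hdet := (Matrix.isUnit_iff_isUnit_det _).mp h𝒳.isUnit
  have h𝒳T : 𝒳ᵀ = 𝒳 := by
    simpa [Matrix.conjTranspose_eq_transpose_of_trivial] using h𝒳.isHermitian.eq
  have h2 : 𝒳⁻¹ * 𝒳 = 1 := Matrix.nonsing_inv_mul _ hdet
  rw [Neg, Matrix.fromBlocks_neg, neg_neg, ← Matrix.transpose_neg,
    posDef_fromBlocks_iff₂₂ _ _ Matrix.PosDef.one,
    -- The factor `𝒳` in the congruence `𝒳 U` exchanges the inequality in `𝒳⁻¹` for one in `𝒳`.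
    ← posDef_congruence_iff (h𝒳.isUnit.mul hU) (M := -(A * 𝒳⁻¹ + 𝒳⁻¹ * Aᵀ + B * Bᵀ))]
  have : -sym (Uᵀ * 𝒳 * A * U) - -(Uᵀ * 𝒳 * B) * (1 : Matrix m m ℝ)⁻¹ * (-(Uᵀ * 𝒳 * B))ᵀ =
      (𝒳 * U)ᵀ * -(A * 𝒳⁻¹ + 𝒳⁻¹ * Aᵀ + B * Bᵀ) * (𝒳 * U) := by
    have e1 : (𝒳 * U)ᵀ * (A * 𝒳⁻¹) * (𝒳 * U) = Uᵀ * 𝒳 * A * U := by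
      rw [Matrix.transpose_mul, h𝒳T]
      calc Uᵀ * 𝒳 * (A * 𝒳⁻¹) * (𝒳 * U) = Uᵀ * 𝒳 * A * (𝒳⁻¹ * 𝒳) * U := by
            simp only [Matrix.mul_assoc]
        _ = _ := by rw [h2, Matrix.mul_one]
    have e2 : (𝒳 * U)ᵀ * (𝒳⁻¹ * Aᵀ) * (𝒳 * U) = (Uᵀ * 𝒳 * A * U)ᵀ := by
      rw [← e1]
      simp [Matrix.transpose_mul, Matrix.transpose_nonsing_inv, h𝒳T, Matrix.mul_assoc]
    have e3 : (𝒳 * U)ᵀ * (B * Bᵀ) * (𝒳 * U) = (Uᵀ * 𝒳 * B) * (Uᵀ * 𝒳 * B)ᵀ := by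
      simp [Matrix.transpose_mul, h𝒳T, Matrix.mul_assoc]
    have e4 : (𝒳 * U)ᵀ * -(A * 𝒳⁻¹ + 𝒳⁻¹ * Aᵀ + B * Bᵀ) * (𝒳 * U) =
        -(Uᵀ * 𝒳 * A * U + (Uᵀ * 𝒳 * A * U)ᵀ + (Uᵀ * 𝒳 * B) * (Uᵀ * 𝒳 * B)ᵀ) := by
      rw [← e3, ← e2, ← e1]
      simp only [Matrix.mul_neg, Matrix.neg_mul, Matrix.mul_add, Matrix.add_mul]
    rw [e4, sym]
    simp only [inv_one, Matrix.mul_one, Matrix.transpose_neg, Matrix.neg_mul, Matrix.mul_neg,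
      neg_neg]
    abel
  rw [this]

omit [Fintype p] [DecidableEq p] in
theorem mul_inv_congruence (hU : IsUnit U) (C : Matrix p n ℝ) :
    C * U * (Uᵀ * 𝒳 * U)⁻¹ * (C * U)ᵀ = C * 𝒳⁻¹ * Cᵀ := by
  have hdet := (Matrix.isUnit_iff_isUnit_det _).mp hU
  have h1 : U * U⁻¹ = 1 := Matrix.mul_nonsing_inv _ hdet
  have h2 : (U⁻¹)ᵀ * Uᵀ = 1 := by rw [← Matrix.transpose_mul, h1, Matrix.transpose_one]
  rw [Matrix.mul_inv_rev, Matrix.mul_inv_rev, ← Matrix.transpose_nonsing_inv, Matrix.transpose_mul]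
  calc C * U * (U⁻¹ * (𝒳⁻¹ * (U⁻¹)ᵀ)) * (Uᵀ * Cᵀ)
      = C * (U * U⁻¹) * 𝒳⁻¹ * ((U⁻¹)ᵀ * Uᵀ) * Cᵀ := by simp only [Matrix.mul_assoc]
    _ = _ := by rw [h1, h2, Matrix.mul_one, Matrix.mul_one]

theorem posDef_performanceBlock_iff (h𝒳 : 𝒳.PosDef) (hU : IsUnit U) (C : Matrix p n ℝ)
    (Q : Matrix p p ℝ) :
    (Matrix.fromBlocks (Uᵀ * 𝒳 * U) (C * U)ᵀ (C * U) Q).PosDef ↔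
      (Q - C * 𝒳⁻¹ * Cᵀ).PosDef := by
  have := posDef_fromBlocks_iff₁₁ (C * U)ᵀ Q ((posDef_congruence_iff hU).mpr h𝒳)
  rwa [Matrix.transpose_transpose, mul_inv_congruence hU] at this

theorem posDef_channelBlock_iff (h𝒳 : 𝒳.PosDef) (hU : IsUnit U) (C : Matrix Unit n ℝ) (γ : ℝ) :
    (Matrix.fromBlocks (Matrix.of fun _ _ => γ) (C * U) (C * U)ᵀ (Uᵀ * 𝒳 * U)).PosDef ↔
      (C * 𝒳⁻¹ * Cᵀ).trace < γ := by
  rw [posDef_fromBlocks_iff₂₂ _ _ ((posDef_congruence_iff hU).mpr h𝒳), mul_inv_congruence hU,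
    posDef_unit_iff, Matrix.trace_sub, sub_pos]
  simp [Matrix.trace]

end Congruence

/-! ### The linearizing congruence -/

section BlockCongruence

variable {m n k l : Type*}

theorem sym_fromBlocks (a : Matrix m m ℝ) (b : Matrix m n ℝ) (c : Matrix n m ℝ)
    (d : Matrix n n ℝ) : sym (Matrix.fromBlocks a b c d) =
      Matrix.fromBlocks (sym a) (b + cᵀ) (c + bᵀ) (sym d) := by
  simp [sym, Matrix.fromBlocks_transpose, Matrix.fromBlocks_add]

theorem row_mul [Fintype n] (M : Matrix m n ℝ) (N : Matrix n k ℝ) (i : m) :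
    row (M * N) i = row M i * N := by
  ext
  simp [row, Matrix.mul_apply]

theorem row_fromCols (M : Matrix m n ℝ) (N : Matrix m k ℝ) (i : m) :
    row (Matrix.fromCols M N) i = Matrix.fromCols (row M i) (row N i) := by
  ext _ (j | j) <;> simp [row]

variable [Fintype n] [DecidableEq n]

/-- The congruence `[X, I; Mᵀ, 0]` linearizing the output-feedback problem. -/
def linearizing (X M : Matrix n n ℝ) : Matrix (n ⊕ n) (n ⊕ n) ℝ := Matrix.fromBlocks X 1 Mᵀ 0

theorem isUnit_linearizing {X M : Matrix n n ℝ} (hM : IsUnit M) : IsUnit (linearizing X M) := by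
  have hdet : IsUnit (Mᵀ).det := by
    rw [Matrix.det_transpose]
    exact (Matrix.isUnit_iff_isUnit_det _).mp hM
  refine IsUnit.of_mul_eq_one (Matrix.fromBlocks 0 (Mᵀ)⁻¹ 1 (-(X * (Mᵀ)⁻¹))) ?_
  rw [linearizing, Matrix.fromBlocks_multiply]
  simp [Matrix.mul_nonsing_inv _ hdet]

omit [Fintype n] [DecidableEq n] in
theorem toBlocks₂₁_eq_transpose {𝒳 : Matrix (n ⊕ n) (n ⊕ n) ℝ} (h : 𝒳ᵀ = 𝒳) :
    𝒳.toBlocks₂₁ = 𝒳.toBlocks₁₂ᵀ := by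
  ext i j
  exact congrFun (congrFun h.symm (Sum.inr i)) (Sum.inl j)

/-- The first block row of the left factor is that of `𝒳⁻¹`, which produces `[I, 0]`; the second is
`[I, 0]`, which picks out the first block row of `𝒳`. -/
theorem linearizing_transpose_mul {𝒳 : Matrix (n ⊕ n) (n ⊕ n) ℝ} (h𝒳 : 𝒳.PosDef) :
    (linearizing (𝒳⁻¹).toBlocks₁₁ (𝒳⁻¹).toBlocks₁₂)ᵀ * 𝒳 =
      Matrix.fromBlocks 1 0 𝒳.toBlocks₁₁ 𝒳.toBlocks₁₂ := by
  have h1 : 𝒳⁻¹ * 𝒳 = 1 :=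
    Matrix.nonsing_inv_mul _ ((Matrix.isUnit_iff_isUnit_det _).mp h𝒳.isUnit)
  have hT : (𝒳⁻¹)ᵀ = 𝒳⁻¹ := by
    simpa [Matrix.conjTranspose_eq_transpose_of_trivial] using h𝒳.inv.isHermitian.eq
  have h11 : (𝒳⁻¹).toBlocks₁₁ᵀ = (𝒳⁻¹).toBlocks₁₁ := by
    ext i j
    exact congrFun (congrFun hT (Sum.inl i)) (Sum.inl j)
  rw [← Matrix.fromBlocks_toBlocks (𝒳⁻¹), ← Matrix.fromBlocks_toBlocks 𝒳,
    Matrix.fromBlocks_multiply, ← Matrix.fromBlocks_one, Matrix.fromBlocks_inj] at h1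
  conv_lhs => rw [← Matrix.fromBlocks_toBlocks 𝒳]
  rw [linearizing, Matrix.fromBlocks_transpose, Matrix.fromBlocks_multiply]
  simp only [Matrix.fromBlocks_toBlocks] at h1 ⊢
  simp [h11, h1.1, h1.2.1]

end BlockCongruence

/-! ### Closed-loop inequalities in the transformed variables -/

section ClosedLoop

variable {nx nu nw nz ny : ℕ} (P : Plant nx nu nw nz ny) (K : Controller nx nu ny)
  {𝒳 : Matrix (Fin nx ⊕ Fin nx) (Fin nx ⊕ Fin nx) ℝ} {Q : Matrix (Fin nz) (Fin nz) ℝ}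
  {γ₀ : ℝ} {Γ : Fin nu → ℝ}

/-- The matrix inequalities characterizing the design constraints for a closed loop with
Lyapunov matrix `W`. -/
structure ClosedLoopFeasible (W : Matrix (Fin nx ⊕ Fin nx) (Fin nx ⊕ Fin nx) ℝ)
    (Q : Matrix (Fin nz) (Fin nz) ℝ) (γ₀ : ℝ) (Γ : Fin nu → ℝ) : Prop where
  lyap : (-(Acl P K * W + W * (Acl P K)ᵀ + Bcl P K * (Bcl P K)ᵀ)).PosDef
  perf : (Q - Ccl P K * W * (Ccl P K)ᵀ).PosDef
  trace_lt : Q.trace < γ₀ ^ 2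
  D_cl : Dcl P K = 0
  channel : ∀ i, (row (Ctilde P K) i * W * (row (Ctilde P K) i)ᵀ).trace < Γ i
  D_u : K.DK * P.Dyw = 0

/-- The congruence attached to a closed-loop Lyapunov matrix. -/
noncomputable abbrev lyapCongruence (𝒳 : Matrix (Fin nx ⊕ Fin nx) (Fin nx ⊕ Fin nx) ℝ) :=
  linearizing (𝒳⁻¹).toBlocks₁₁ (𝒳⁻¹).toBlocks₁₂

/-- This product explains the change of variables: the terms nonlinear in the controller and `𝒳` are
absorbed into `Ah`, `Bh`, `Ch`. The matrix `Q` is carried along without effect. -/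
theorem Acl_congruence (h𝒳 : 𝒳.PosDef) (Q : Matrix (Fin nz) (Fin nz) ℝ) :
    (lyapCongruence 𝒳)ᵀ * 𝒳 * Acl P K * lyapCongruence 𝒳 =
      Matrix.fromBlocks
        (P.A * (transformVars P K 𝒳 Q).X + P.Bu * (transformVars P K 𝒳 Q).Ch)
        (P.A + P.Bu * (transformVars P K 𝒳 Q).Dh * P.Cy)
        (transformVars P K 𝒳 Q).Ah
        ((transformVars P K 𝒳 Q).Y * P.A + (transformVars P K 𝒳 Q).Bh * P.Cy) := by
  rw [lyapCongruence, linearizing_transpose_mul h𝒳, Acl, linearizing,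
    Matrix.fromBlocks_multiply, Matrix.fromBlocks_multiply]
  simp only [transformVars, Matrix.one_mul, Matrix.zero_mul, Matrix.mul_one, Matrix.mul_zero,
    add_zero]
  congr 1 <;> simp only [Matrix.mul_add, Matrix.add_mul, Matrix.mul_assoc] <;> abel

theorem Bcl_congruence (h𝒳 : 𝒳.PosDef) (Q : Matrix (Fin nz) (Fin nz) ℝ) :
    (lyapCongruence 𝒳)ᵀ * 𝒳 * Bcl P K =
      Matrix.fromRows
        (P.Bw + P.Bu * (transformVars P K 𝒳 Q).Dh * P.Dyw)
        ((transformVars P K 𝒳 Q).Y * P.Bw + (transformVars P K 𝒳 Q).Bh * P.Dyw) := by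
  rw [lyapCongruence, linearizing_transpose_mul h𝒳, Bcl, Matrix.fromBlocks_mul_fromRows]
  simp only [transformVars, Matrix.one_mul, Matrix.zero_mul, add_zero]
  congr 1
  simp only [Matrix.mul_add, Matrix.add_mul, Matrix.mul_assoc]
  abel

theorem Ccl_congruence (𝒳 : Matrix (Fin nx ⊕ Fin nx) (Fin nx ⊕ Fin nx) ℝ)
    (Q : Matrix (Fin nz) (Fin nz) ℝ) :
    Ccl P K * lyapCongruence 𝒳 =
      Matrix.fromCols
        (P.Cz * (transformVars P K 𝒳 Q).X + P.Du * (transformVars P K 𝒳 Q).Ch)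
        (P.Cz + P.Du * (transformVars P K 𝒳 Q).Dh * P.Cy) := by
  rw [lyapCongruence, Ccl, linearizing, Matrix.fromCols_mul_fromBlocks]
  simp only [transformVars, Matrix.mul_one, Matrix.mul_zero, add_zero]
  congr 1
  simp only [Matrix.mul_add, Matrix.add_mul, Matrix.mul_assoc]
  abel

theorem Ctilde_congruence (𝒳 : Matrix (Fin nx ⊕ Fin nx) (Fin nx ⊕ Fin nx) ℝ)
    (Q : Matrix (Fin nz) (Fin nz) ℝ) :
    Ctilde P K * lyapCongruence 𝒳 =
      Matrix.fromCols (transformVars P K 𝒳 Q).Ch ((transformVars P K 𝒳 Q).Dh * P.Cy) := by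
  rw [lyapCongruence, Ctilde, linearizing, Matrix.fromCols_mul_fromBlocks]
  simp only [transformVars, Matrix.mul_one, Matrix.mul_zero, add_zero]
  congr 1
  exact add_comm _ _

theorem Xcl_congruence (h𝒳 : 𝒳.PosDef) (Q : Matrix (Fin nz) (Fin nz) ℝ) :
    (lyapCongruence 𝒳)ᵀ * 𝒳 * lyapCongruence 𝒳 =
      Matrix.fromBlocks (transformVars P K 𝒳 Q).X 1 1 (transformVars P K 𝒳 Q).Y := by
  have h1 : 𝒳 * 𝒳⁻¹ = 1 :=
    Matrix.mul_nonsing_inv _ ((Matrix.isUnit_iff_isUnit_det _).mp h𝒳.isUnit)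
  have hT : (𝒳⁻¹)ᵀ = 𝒳⁻¹ := by
    simpa [Matrix.conjTranspose_eq_transpose_of_trivial] using h𝒳.inv.isHermitian.eq
  rw [← Matrix.fromBlocks_toBlocks (𝒳⁻¹), ← Matrix.fromBlocks_toBlocks 𝒳,
    Matrix.fromBlocks_multiply, ← Matrix.fromBlocks_one, Matrix.fromBlocks_inj] at h1
  simp only [Matrix.fromBlocks_toBlocks] at h1
  rw [lyapCongruence, linearizing_transpose_mul h𝒳, linearizing, Matrix.fromBlocks_multiply,
    ← toBlocks₂₁_eq_transpose hT]
  simp [transformVars, h1.1]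

theorem lyapMatrix_transformVars (h𝒳 : 𝒳.PosDef) (Q : Matrix (Fin nz) (Fin nz) ℝ) :
    lyapMatrix P (transformVars P K 𝒳 Q) =
      Matrix.fromBlocks (sym ((lyapCongruence 𝒳)ᵀ * 𝒳 * Acl P K * lyapCongruence 𝒳))
        ((lyapCongruence 𝒳)ᵀ * 𝒳 * Bcl P K) ((lyapCongruence 𝒳)ᵀ * 𝒳 * Bcl P K)ᵀ (-1) := by
  rw [Acl_congruence P K h𝒳 Q, Bcl_congruence P K h𝒳 Q, sym_fromBlocks, lyapMatrix,
    Matrix.transpose_fromRows]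
  congr 2
  rw [Matrix.transpose_add, Matrix.transpose_transpose, add_comm]

theorem perfMatrix_transformVars (h𝒳 : 𝒳.PosDef) (Q : Matrix (Fin nz) (Fin nz) ℝ) :
    perfMatrix P (transformVars P K 𝒳 Q) =
      Matrix.fromBlocks ((lyapCongruence 𝒳)ᵀ * 𝒳 * lyapCongruence 𝒳)
        (Ccl P K * lyapCongruence 𝒳)ᵀ (Ccl P K * lyapCongruence 𝒳) Q := by
  rw [Xcl_congruence P K h𝒳 Q, Ccl_congruence P K 𝒳 Q, perfMatrix, Matrix.transpose_fromCols]
  rfl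

theorem channelMatrix_transformVars (h𝒳 : 𝒳.PosDef) (Q : Matrix (Fin nz) (Fin nz) ℝ) (γ : ℝ)
    (i : Fin nu) :
    channelMatrix P (transformVars P K 𝒳 Q) γ i =
      Matrix.fromBlocks (Matrix.of fun _ _ => γ) (row (Ctilde P K) i * lyapCongruence 𝒳)
        (row (Ctilde P K) i * lyapCongruence 𝒳)ᵀ
        ((lyapCongruence 𝒳)ᵀ * 𝒳 * lyapCongruence 𝒳) := by
  rw [Xcl_congruence P K h𝒳 Q, ← row_mul, Ctilde_congruence P K 𝒳 Q, channelMatrix, row_fromCols,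
    Matrix.transpose_fromCols]

theorem lmiFeasible_transformVars_iff (h𝒳 : 𝒳.PosDef) (hM : IsUnit (𝒳⁻¹).toBlocks₁₂) :
    LMIFeasible P (transformVars P K 𝒳 Q) γ₀ Γ ↔ ClosedLoopFeasible P K 𝒳⁻¹ Q γ₀ Γ := by
  have hU := isUnit_linearizing (X := (𝒳⁻¹).toBlocks₁₁) hM
  have hlyap : Neg (lyapMatrix P (transformVars P K 𝒳 Q)) ↔
      (-(Acl P K * 𝒳⁻¹ + 𝒳⁻¹ * (Acl P K)ᵀ + Bcl P K * (Bcl P K)ᵀ)).PosDef := by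
    rw [lyapMatrix_transformVars P K h𝒳 Q]
    exact neg_lyapunovBlock_iff h𝒳 hU _ _
  have hperf : Pos (perfMatrix P (transformVars P K 𝒳 Q)) ↔
      (Q - Ccl P K * 𝒳⁻¹ * (Ccl P K)ᵀ).PosDef := by
    rw [perfMatrix_transformVars P K h𝒳 Q]
    exact posDef_performanceBlock_iff h𝒳 hU _ _
  have hchan : ∀ i, Pos (channelMatrix P (transformVars P K 𝒳 Q) (Γ i) i) ↔
      (row (Ctilde P K) i * 𝒳⁻¹ * (row (Ctilde P K) i)ᵀ).trace < Γ i := by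
    intro i
    rw [channelMatrix_transformVars P K h𝒳 Q]
    exact posDef_channelBlock_iff h𝒳 hU _ _
  have hX := h𝒳.inv.posSemidef
  constructor
  · intro h
    exact ⟨hlyap.mp h.lyap, hperf.mp h.perf, h.trace_lt, h.D_cl,
      fun i => (hchan i).mp (h.channel i), h.D_u⟩
  · intro h
    -- The remaining sign conditions are automatic: `Γ i` exceeds a nonnegative trace, `X` and `Y`
    -- are principal blocks, and `Q` dominates a semidefinite matrix strictly.
    refine ⟨fun i => ?_, ?_, ?_, ?_, hlyap.mpr h.lyap, hperf.mpr h.perf, h.trace_lt, h.D_cl,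
      fun i => (hchan i).mpr (h.channel i), h.D_u⟩
    · refine lt_of_le_of_lt ?_ (h.channel i)
      have := (hX.mul_mul_conjTranspose_same (row (Ctilde P K) i)).trace_nonneg
      rwa [Matrix.conjTranspose_eq_transpose_of_trivial] at this
    · exact h𝒳.inv.submatrix Sum.inl_injective
    · exact h𝒳.submatrix Sum.inl_injective
    · have := hX.mul_mul_conjTranspose_same (Ccl P K)
      rw [Matrix.conjTranspose_eq_transpose_of_trivial] at this
      have h2 := h.perf.add_posSemidef this
      rwa [sub_add_cancel] at h2

/-- The Schur complement `Y - X⁻¹` is positive definite and `I - X Y = -X (Y - X⁻¹)`. -/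
theorem LMIFeasible.isUnit_one_sub {P : Plant nx nu nw nz ny} {V : LMIVars nx nu nz ny}
    (h : LMIFeasible P V γ₀ Γ) : IsUnit (1 - V.X * V.Y) := by
  have h1 : (Matrix.fromBlocks V.X 1 1 V.Y).PosDef :=
    h.perf.submatrix (e := Sum.inl) Sum.inl_injective
  have h2 := posDef_fromBlocks_iff₁₁ 1 V.Y h.X_pos
  rw [Matrix.transpose_one, Matrix.mul_one, Matrix.one_mul] at h2
  have h3 := (h.X_pos.isUnit.mul (h2.mp h1).isUnit).neg
  rwa [Matrix.mul_sub, Matrix.mul_nonsing_inv _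
    ((Matrix.isUnit_iff_isUnit_det _).mp h.X_pos.isUnit), neg_sub] at h3

theorem toBlocks₁₂_mul_transpose (h𝒳 : 𝒳.PosDef) :
    (𝒳⁻¹).toBlocks₁₂ * 𝒳.toBlocks₁₂ᵀ = 1 - (𝒳⁻¹).toBlocks₁₁ * 𝒳.toBlocks₁₁ := by
  have h1 : 𝒳⁻¹ * 𝒳 = 1 :=
    Matrix.nonsing_inv_mul _ ((Matrix.isUnit_iff_isUnit_det _).mp h𝒳.isUnit)
  have hT : 𝒳ᵀ = 𝒳 := by
    simpa [Matrix.conjTranspose_eq_transpose_of_trivial] using h𝒳.isHermitian.eq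
  rw [← Matrix.fromBlocks_toBlocks (𝒳⁻¹), ← Matrix.fromBlocks_toBlocks 𝒳,
    Matrix.fromBlocks_multiply, ← Matrix.fromBlocks_one, Matrix.fromBlocks_inj] at h1
  simp only [Matrix.fromBlocks_toBlocks] at h1
  rw [← toBlocks₂₁_eq_transpose hT, ← h1.1]
  abel

theorem isUnit_and_isUnit_of_mul_transpose {n : Type*} [Fintype n] [DecidableEq n]
    {M N Z : Matrix n n ℝ} (hZ : IsUnit Z) (h : M * Nᵀ = Z) : IsUnit M ∧ IsUnit N := by
  rw [← h, Matrix.isUnit_iff_isUnit_det, Matrix.det_mul, Matrix.det_transpose,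
    IsUnit.mul_iff] at hZ
  exact ⟨(Matrix.isUnit_iff_isUnit_det _).mpr hZ.1, (Matrix.isUnit_iff_isUnit_det _).mpr hZ.2⟩

theorem reconstruct_transformVars (hM : IsUnit (𝒳⁻¹).toBlocks₁₂) (hN : IsUnit 𝒳.toBlocks₁₂)
    (Q : Matrix (Fin nz) (Fin nz) ℝ) :
    reconstruct P (transformVars P K 𝒳 Q) (𝒳⁻¹).toBlocks₁₂ 𝒳.toBlocks₁₂ = K := by
  set M := (𝒳⁻¹).toBlocks₁₂ with hMdef
  set N := 𝒳.toBlocks₁₂ with hNdef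
  have hMM : Mᵀ * (Mᵀ)⁻¹ = 1 := Matrix.mul_nonsing_inv _ (by
    rw [Matrix.det_transpose]
    exact (Matrix.isUnit_iff_isUnit_det _).mp hM)
  have hNN : N⁻¹ * N = 1 :=
    Matrix.nonsing_inv_mul _ ((Matrix.isUnit_iff_isUnit_det _).mp hN)
  have hC : (reconstruct P (transformVars P K 𝒳 Q) M N).CK = K.CK := by
    simp only [reconstruct, transformVars, ← hMdef]
    rw [add_sub_cancel_right, Matrix.mul_assoc, hMM, Matrix.mul_one]
  have hB : (reconstruct P (transformVars P K 𝒳 Q) M N).BK = K.BK := by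
    simp only [reconstruct, transformVars, ← hNdef]
    rw [add_sub_cancel_right, ← Matrix.mul_assoc, hNN, Matrix.one_mul]
  refine Controller.ext ?_ hB hC rfl
  have hA : (reconstruct P (transformVars P K 𝒳 Q) M N).AK =
      N⁻¹ * ((transformVars P K 𝒳 Q).Ah
        - N * (reconstruct P (transformVars P K 𝒳 Q) M N).BK * P.Cy * (transformVars P K 𝒳 Q).X
        - (transformVars P K 𝒳 Q).Y * P.Bu *
          (reconstruct P (transformVars P K 𝒳 Q) M N).CK * Mᵀ
        - (transformVars P K 𝒳 Q).Y * (P.A + P.Bu * (transformVars P K 𝒳 Q).Dh * P.Cy) *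
          (transformVars P K 𝒳 Q).X) * (Mᵀ)⁻¹ := rfl
  rw [hA, hB, hC]
  simp only [transformVars, ← hMdef, ← hNdef]
  rw [show ∀ a b c d : Matrix (Fin nx) (Fin nx) ℝ, a + b + c + d - b - c - d = a from
    fun a b c d => by abel]
  calc N⁻¹ * (N * K.AK * Mᵀ) * (Mᵀ)⁻¹ = (N⁻¹ * N) * K.AK * (Mᵀ * (Mᵀ)⁻¹) := by
        simp only [Matrix.mul_assoc]
    _ = K.AK := by rw [hNN, hMM, Matrix.one_mul, Matrix.mul_one]

/-- A solution of the LMIs comes from a closed-loop Lyapunov matrix for the reconstructed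
controller. -/
theorem LMIFeasible.exists_transformVars_eq {P : Plant nx nu nw nz ny} {V : LMIVars nx nu nz ny}
    (h : LMIFeasible P V γ₀ Γ) {M N : Matrix (Fin nx) (Fin nx) ℝ} (hM : IsUnit M) (hN : IsUnit N)
    (hMN : M * Nᵀ = 1 - V.X * V.Y) :
    ∃ 𝒳 : Matrix (Fin nx ⊕ Fin nx) (Fin nx ⊕ Fin nx) ℝ, 𝒳.PosDef ∧
      (𝒳⁻¹).toBlocks₁₂ = M ∧ transformVars P (reconstruct P V M N) 𝒳 V.Q = V := by
  have hXY : (Matrix.fromBlocks V.X 1 1 V.Y).PosDef :=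
    h.perf.submatrix (e := Sum.inl) Sum.inl_injective
  have hXT : V.Xᵀ = V.X := by
    simpa [Matrix.conjTranspose_eq_transpose_of_trivial] using h.X_pos.isHermitian.eq
  set U := linearizing V.X M with hUdef
  have hU : IsUnit U := isUnit_linearizing hM
  have hUU : U⁻¹ * U = 1 := Matrix.nonsing_inv_mul _ ((Matrix.isUnit_iff_isUnit_det _).mp hU)
  -- The transpose of `linearizing_transpose_mul` prescribes `𝒳 U`, hence `𝒳`.
  obtain ⟨𝒳, h𝒳def⟩ : ∃ 𝒳, 𝒳 = Matrix.fromBlocks 1 V.Y 0 Nᵀ * U⁻¹ := ⟨_, rfl⟩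
  have h𝒳U : 𝒳 * U = Matrix.fromBlocks 1 V.Y 0 Nᵀ := by
    rw [h𝒳def, Matrix.mul_assoc, hUU, Matrix.mul_one]
  -- The relation `M Nᵀ = I - X Y` makes `Uᵀ 𝒳 U` equal to `[X, I; I, Y]`; symmetry of `𝒳` comes
  -- with its definiteness.
  have h𝒳 : 𝒳.PosDef := by
    rw [← posDef_congruence_iff hU, Matrix.mul_assoc, h𝒳U, hUdef, linearizing,
      Matrix.fromBlocks_transpose, Matrix.fromBlocks_multiply]
    simpa [hXT, hMN] using hXY
  have h𝒳T : 𝒳ᵀ = 𝒳 := by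
    simpa [Matrix.conjTranspose_eq_transpose_of_trivial] using h𝒳.isHermitian.eq
  have h𝒳iT : (𝒳⁻¹)ᵀ = 𝒳⁻¹ := by
    simpa [Matrix.conjTranspose_eq_transpose_of_trivial] using h𝒳.inv.isHermitian.eq
  have hinv : 𝒳⁻¹ * Matrix.fromBlocks 1 V.Y 0 Nᵀ = U := by
    rw [← h𝒳U, ← Matrix.mul_assoc,
      Matrix.nonsing_inv_mul _ ((Matrix.isUnit_iff_isUnit_det _).mp h𝒳.isUnit), Matrix.one_mul]
  rw [← Matrix.fromBlocks_toBlocks 𝒳, hUdef, linearizing, Matrix.fromBlocks_multiply,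
    Matrix.fromBlocks_inj] at h𝒳U
  rw [← Matrix.fromBlocks_toBlocks 𝒳⁻¹, hUdef, linearizing, Matrix.fromBlocks_multiply,
    Matrix.fromBlocks_inj] at hinv
  simp only [Matrix.mul_one, Matrix.mul_zero, add_zero] at h𝒳U hinv
  have e11 : 𝒳.toBlocks₁₁ = V.Y := h𝒳U.2.1
  have e12 : 𝒳.toBlocks₁₂ = N := by
    have := h𝒳U.2.2.2
    rw [toBlocks₂₁_eq_transpose h𝒳T] at this
    exact Matrix.transpose_injective this
  have f11 : (𝒳⁻¹).toBlocks₁₁ = V.X := hinv.1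
  have f12 : (𝒳⁻¹).toBlocks₁₂ = M := by
    have := hinv.2.2.1
    rw [toBlocks₂₁_eq_transpose h𝒳iT] at this
    exact Matrix.transpose_injective this
  refine ⟨𝒳, h𝒳, f12, ?_⟩
  have hMM' : (Mᵀ)⁻¹ * Mᵀ = 1 := Matrix.nonsing_inv_mul _ (by
    rw [Matrix.det_transpose]
    exact (Matrix.isUnit_iff_isUnit_det _).mp hM)
  have hNN : N * N⁻¹ = 1 :=
    Matrix.mul_nonsing_inv _ ((Matrix.isUnit_iff_isUnit_det _).mp hN)
  obtain ⟨X, Y, Ah, Bh, Ch, Dh, Q⟩ := V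
  simp only [transformVars, e11, e12, f11, f12, LMIVars.mk.injEq, true_and, and_true]
  have hC : (reconstruct P ⟨X, Y, Ah, Bh, Ch, Dh, Q⟩ M N).CK * Mᵀ = Ch - Dh * P.Cy * X := by
    simp only [reconstruct]
    rw [Matrix.mul_assoc, hMM', Matrix.mul_one]
  have hB : N * (reconstruct P ⟨X, Y, Ah, Bh, Ch, Dh, Q⟩ M N).BK = Bh - Y * P.Bu * Dh := by
    simp only [reconstruct]
    rw [← Matrix.mul_assoc, hNN, Matrix.one_mul]
  have hD : (reconstruct P ⟨X, Y, Ah, Bh, Ch, Dh, Q⟩ M N).DK = Dh := rfl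
  have hA : N * (reconstruct P ⟨X, Y, Ah, Bh, Ch, Dh, Q⟩ M N).AK * Mᵀ =
      Ah - N * (reconstruct P ⟨X, Y, Ah, Bh, Ch, Dh, Q⟩ M N).BK * P.Cy * X -
        Y * P.Bu * (reconstruct P ⟨X, Y, Ah, Bh, Ch, Dh, Q⟩ M N).CK * Mᵀ -
        Y * (P.A + P.Bu * Dh * P.Cy) * X := by
    have : ∀ E : Matrix (Fin nx) (Fin nx) ℝ, N * (N⁻¹ * E * (Mᵀ)⁻¹) * Mᵀ = E := by
      intro E
      calc N * (N⁻¹ * E * (Mᵀ)⁻¹) * Mᵀ = (N * N⁻¹) * E * ((Mᵀ)⁻¹ * Mᵀ) := by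
            simp only [Matrix.mul_assoc]
        _ = E := by rw [hNN, hMM', Matrix.one_mul, Matrix.mul_one]
    exact this _
  refine ⟨?_, ?_, ?_, hD⟩
  · rw [hA, hD]
    abel
  · rw [hB, hD, sub_add_cancel]
  · rw [hC, hD, sub_add_cancel]

end ClosedLoop

/-! ### Equivalence of the design constraints and the LMIs -/

section Design

variable {nx nu nw nz ny : ℕ} {P : Plant nx nu nw nz ny} {K : Controller nx nu ny}
  {W : Matrix (Fin nx ⊕ Fin nx) (Fin nx ⊕ Fin nx) ℝ} {Q : Matrix (Fin nz) (Fin nz) ℝ}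
  {γ₀ : ℝ} {Γ : Fin nu → ℝ}

theorem ClosedLoopFeasible.designFeasible (hγ₀ : 0 < γ₀) (hW : W.PosDef)
    (h : ClosedLoopFeasible P K W Q γ₀ Γ) : DesignFeasible P K γ₀ Γ := by
  have hBB : (Bcl P K * (Bcl P K)ᵀ).PosSemidef := by
    simpa using Matrix.posSemidef_self_mul_conjTranspose (Bcl P K)
  have hA : Hurwitz (Acl P K) := by
    refine hurwitz_of_lyapunov hW ?_
    have := h.lyap.add_posSemidef hBB
    rwa [neg_add_rev, neg_add_cancel_comm] at this
  refine ⟨hA, ?_, fun i => ?_⟩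
  · have h1 := hA.h2Norm_transfer_le (C := Ccl P K) h.lyap.posSemidef
    rw [Gcl, h.D_cl]
    refine h1.trans_lt ((ENNReal.ofReal_lt_ofReal_iff hγ₀).mpr ?_)
    rw [Real.sqrt_lt' hγ₀]
    have h2 := h.perf.posSemidef.trace_nonneg
    rw [Matrix.trace_sub] at h2
    linarith [h.trace_lt]
  · have h1 := hA.h2Norm_transfer_le (C := row (Ctilde P K) i) h.lyap.posSemidef
    have h0 : row (K.DK * P.Dyw) i = 0 := by
      rw [h.D_u]
      rfl
    have htr := (hW.posSemidef.mul_mul_conjTranspose_same (row (Ctilde P K) i)).trace_nonneg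
    rw [Matrix.conjTranspose_eq_transpose_of_trivial] at htr
    rw [Gu, h0]
    have hlt := Real.sqrt_lt_sqrt htr (h.channel i)
    exact h1.trans_lt
      ((ENNReal.ofReal_lt_ofReal_iff ((Real.sqrt_nonneg _).trans_lt hlt)).mpr hlt)

/-- A feasible design admits a closed-loop Lyapunov matrix with invertible off-diagonal block. -/
theorem DesignFeasible.exists_closedLoopFeasible (hγ₀ : 0 < γ₀) (h : DesignFeasible P K γ₀ Γ) :
    ∃ (W : Matrix (Fin nx ⊕ Fin nx) (Fin nx ⊕ Fin nx) ℝ) (Q : Matrix (Fin nz) (Fin nz) ℝ),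
      W.PosDef ∧ IsUnit W.toBlocks₁₂ ∧ ClosedLoopFeasible P K W Q γ₀ Γ := by
  obtain ⟨hA, hG, hU⟩ := h
  have hD : Dcl P K = 0 := feedthrough_eq_zero_of_h2Norm_lt_top (hG.trans ENNReal.ofReal_lt_top)
  have hDu : K.DK * P.Dyw = 0 := by
    ext i j
    have := feedthrough_eq_zero_of_h2Norm_lt_top ((hU i).trans ENNReal.ofReal_lt_top)
    exact congrFun (congrFun this ()) j
  have hBB : (Bcl P K * (Bcl P K)ᵀ).PosSemidef := by
    simpa using Matrix.posSemidef_self_mul_conjTranspose (Bcl P K)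
  -- `P₀` is the Gramian, possibly singular; adding `ε • P₁` makes it definite and gives the
  -- Lyapunov inequality the slack `ε • 1`.
  obtain ⟨P₀, hP₀⟩ := hA.exists_lyapunov (Bcl P K * (Bcl P K)ᵀ)
  obtain ⟨P₁, hP₁⟩ := hA.exists_lyapunov 1
  have hP₀psd := hA.lyapunov_posSemidef hBB hP₀
  have hP₁pos := hA.lyapunov_posDef Matrix.PosDef.one hP₁
  have hz : (Ccl P K * P₀ * (Ccl P K)ᵀ).trace < γ₀ ^ 2 := by
    rw [Gcl, hD, hA.h2Norm_transfer hP₀, ENNReal.ofReal_lt_ofReal_iff hγ₀,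
      Real.sqrt_lt' hγ₀] at hG
    exact hG
  have hu : ∀ i, (row (Ctilde P K) i * P₀ * (row (Ctilde P K) i)ᵀ).trace < Γ i := by
    intro i
    have h0 : row (K.DK * P.Dyw) i = 0 := by
      rw [hDu]
      rfl
    have := hU i
    rw [Gu, h0, hA.h2Norm_transfer hP₀] at this
    -- The contrapositive needs only monotonicity of the square root, so `Γ i ≤ 0` requires no
    -- separate case.
    by_contra hle
    exact absurd this (not_lt.mpr (ENNReal.ofReal_le_ofReal (Real.sqrt_le_sqrt (not_lt.mp hle))))
  -- perturbation of traces along a line of Lyapunov matrices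
  have hcont : ∀ {p : Type} [Fintype p] (C : Matrix p (Fin nx ⊕ Fin nx) ℝ)
      (M H : Matrix (Fin nx ⊕ Fin nx) (Fin nx ⊕ Fin nx) ℝ) (c : ℝ),
      (C * M * Cᵀ).trace < c → ∀ᶠ t : ℝ in 𝓝 0, (C * (M + t • H) * Cᵀ).trace < c := by
    intro p _ C M H c hc
    have hlin : ∀ t : ℝ, (C * (M + t • H) * Cᵀ).trace =
        (C * M * Cᵀ).trace + t * (C * H * Cᵀ).trace := by
      intro t
      rw [Matrix.mul_add, Matrix.add_mul, Matrix.trace_add, Matrix.mul_smul, Matrix.smul_mul,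
        Matrix.trace_smul, smul_eq_mul]
    have hc' : Continuous fun t : ℝ => (C * (M + t • H) * Cᵀ).trace := by
      simp_rw [hlin]
      fun_prop
    have := hc'.tendsto 0
    refine this.eventually (gt_mem_nhds ?_)
    simpa using hc
  obtain ⟨ε, ⟨hεz, hεu⟩, hε⟩ := ((((hcont _ P₀ P₁ _ hz).and
    (eventually_all.mpr fun i => hcont _ P₀ P₁ _ (hu i))).filter_mono nhdsWithin_le_nhds).and
    (self_mem_nhdsWithin : Set.Ioi (0 : ℝ) ∈ 𝓝[>] 0)).exists
  set W₀ := P₀ + ε • P₁ with hW₀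
  have hW₀pos : W₀.PosDef := Matrix.PosDef.posSemidef_add hP₀psd (hP₁pos.smul hε)
  have hlyap₀ : (-(Acl P K * W₀ + W₀ * (Acl P K)ᵀ + Bcl P K * (Bcl P K)ᵀ)).PosDef := by
    have : -(Acl P K * W₀ + W₀ * (Acl P K)ᵀ + Bcl P K * (Bcl P K)ᵀ) =
        ε • (1 : Matrix (Fin nx ⊕ Fin nx) (Fin nx ⊕ Fin nx) ℝ) := by
      have e : Acl P K * W₀ + W₀ * (Acl P K)ᵀ =
          (Acl P K * P₀ + P₀ * (Acl P K)ᵀ) + ε • (Acl P K * P₁ + P₁ * (Acl P K)ᵀ) := by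
        rw [hW₀, Matrix.mul_add, Matrix.add_mul, Matrix.mul_smul, Matrix.smul_mul, smul_add]
        abel
      rw [e, hP₀, hP₁, smul_neg]
      abel
    rw [this]
    exact Matrix.PosDef.one.smul hε
  -- The off-diagonal block of `W₀` may be singular. Moving along `J` shifts it by `t • 1`,
  -- invertible for all small `t ≠ 0`, while the strict inequalities persist.
  obtain ⟨J, hJ⟩ : ∃ J : Matrix (Fin nx ⊕ Fin nx) (Fin nx ⊕ Fin nx) ℝ,
    J = Matrix.fromBlocks 0 1 1 0 := ⟨_, rfl⟩
  have hJT : Jᵀ = J := by rw [hJ, Matrix.fromBlocks_transpose]; simp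
  have hHT : (-(Acl P K * J + J * (Acl P K)ᵀ))ᵀ = -(Acl P K * J + J * (Acl P K)ᵀ) := by
    simp [Matrix.transpose_mul, hJT, add_comm]
  obtain ⟨t, ⟨htz, htu, htpos, htlyap⟩, htunit⟩ := ((((hcont _ W₀ J _ hεz).and
    ((eventually_all.mpr fun i => hcont _ W₀ J _ (hεu i)).and
    ((eventually_posDef_add_smul hW₀pos hJT).and
    (eventually_posDef_add_smul hlyap₀ hHT)))).filter_mono nhdsWithin_le_nhds).and
    (eventually_isUnit_add_smul_one W₀.toBlocks₁₂)).exists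
  set W := W₀ + t • J with hW
  -- The slack `δ • 1`, of trace `δ * nz`, makes `Q` strictly larger than the output covariance
  -- within the trace bound.
  obtain ⟨δ, hδtr, hδ⟩ : ∃ δ : ℝ, (Ccl P K * W * (Ccl P K)ᵀ).trace + δ * nz < γ₀ ^ 2 ∧ 0 < δ := by
    have hc : Continuous fun δ : ℝ => (Ccl P K * W * (Ccl P K)ᵀ).trace + δ * nz := by fun_prop
    have h1 : ∀ᶠ δ : ℝ in 𝓝 0, (Ccl P K * W * (Ccl P K)ᵀ).trace + δ * nz < γ₀ ^ 2 :=
      (hc.tendsto 0).eventually (gt_mem_nhds (by simpa using htz))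
    exact ((h1.filter_mono nhdsWithin_le_nhds).and
      (self_mem_nhdsWithin : Set.Ioi (0 : ℝ) ∈ 𝓝[>] 0)).exists
  refine ⟨W, Ccl P K * W * (Ccl P K)ᵀ + δ • 1, htpos, ?_, ?_, ?_, ?_, hD, htu, hDu⟩
  · have : W.toBlocks₁₂ = W₀.toBlocks₁₂ + t • (1 : Matrix (Fin nx) (Fin nx) ℝ) := by
      ext i j
      simp [hW, hJ, Matrix.toBlocks₁₂]
    rw [this]
    exact htunit
  · have : -(Acl P K * W + W * (Acl P K)ᵀ + Bcl P K * (Bcl P K)ᵀ) =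
        -(Acl P K * W₀ + W₀ * (Acl P K)ᵀ + Bcl P K * (Bcl P K)ᵀ) +
          t • -(Acl P K * J + J * (Acl P K)ᵀ) := by
      rw [hW, Matrix.mul_add, Matrix.add_mul, Matrix.mul_smul, Matrix.smul_mul, smul_neg, smul_add]
      abel
    rw [this]
    exact htlyap
  · rw [add_sub_cancel_left]
    exact Matrix.PosDef.one.smul hδ
  · rw [Matrix.trace_add, Matrix.trace_smul, Matrix.trace_one, Fintype.card_fin, smul_eq_mul]
    exact hδtr

/-- Feasible designs give feasible LMI variables by the change of variables. -/
theorem DesignFeasible.exists_lmiFeasible (hγ₀ : 0 < γ₀) (h : DesignFeasible P K γ₀ Γ) :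
    ∃ (𝒳 : Matrix (Fin nx ⊕ Fin nx) (Fin nx ⊕ Fin nx) ℝ) (Q : Matrix (Fin nz) (Fin nz) ℝ),
      𝒳.PosDef ∧ LMIFeasible P (transformVars P K 𝒳 Q) γ₀ Γ := by
  obtain ⟨W, Q, hW, hunit, hcl⟩ := h.exists_closedLoopFeasible hγ₀
  have hinv : (W⁻¹)⁻¹ = W :=
    Matrix.nonsing_inv_nonsing_inv _ ((Matrix.isUnit_iff_isUnit_det _).mp hW.isUnit)
  refine ⟨W⁻¹, Q, hW.inv, ?_⟩
  rw [lmiFeasible_transformVars_iff P K hW.inv (by rwa [hinv]), hinv]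
  exact hcl

/-- Feasibility of the LMIs alone forces both off-diagonal blocks to be invertible, so no such
condition on `𝒳` has to be imposed. -/
theorem LMIFeasible.isUnit_toBlocks₁₂
    {𝒳 : Matrix (Fin nx ⊕ Fin nx) (Fin nx ⊕ Fin nx) ℝ} (h𝒳 : 𝒳.PosDef)
    (h : LMIFeasible P (transformVars P K 𝒳 Q) γ₀ Γ) :
    IsUnit (𝒳⁻¹).toBlocks₁₂ ∧ IsUnit 𝒳.toBlocks₁₂ :=
  isUnit_and_isUnit_of_mul_transpose h.isUnit_one_sub (toBlocks₁₂_mul_transpose h𝒳)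

theorem LMIFeasible.designFeasible (hγ₀ : 0 < γ₀)
    {𝒳 : Matrix (Fin nx ⊕ Fin nx) (Fin nx ⊕ Fin nx) ℝ} (h𝒳 : 𝒳.PosDef)
    (h : LMIFeasible P (transformVars P K 𝒳 Q) γ₀ Γ) : DesignFeasible P K γ₀ Γ :=
  ((lmiFeasible_transformVars_iff P K h𝒳
    (h.isUnit_toBlocks₁₂ h𝒳).1).mp h).designFeasible hγ₀ h𝒳.inv

theorem LMIFeasible.designFeasible_reconstruct (hγ₀ : 0 < γ₀) {V : LMIVars nx nu nz ny}
    (h : LMIFeasible P V γ₀ Γ) {M N : Matrix (Fin nx) (Fin nx) ℝ} (hM : IsUnit M) (hN : IsUnit N)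
    (hMN : M * Nᵀ = 1 - V.X * V.Y) : DesignFeasible P (reconstruct P V M N) γ₀ Γ := by
  obtain ⟨𝒳, h𝒳, -, heq⟩ := h.exists_transformVars_eq hM hN hMN
  exact LMIFeasible.designFeasible (Q := V.Q) hγ₀ h𝒳 (by rwa [heq])

theorem LMIFeasible.exists_factorization {V : LMIVars nx nu nz ny} (h : LMIFeasible P V γ₀ Γ) :
    ∃ M N : Matrix (Fin nx) (Fin nx) ℝ, IsUnit M ∧ IsUnit N ∧ M * Nᵀ = 1 - V.X * V.Y :=
  ⟨1 - V.X * V.Y, 1, h.isUnit_one_sub, isUnit_one, by simp⟩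

end Design

end SparseH2

theorem theorem4 {nx nu nw nz ny : ℕ} (P : SparseH2.Plant nx nu nw nz ny)
    (γ₀ : ℝ) (hγ₀ : 0 < γ₀) (ρ : Fin nu → ℝ) (hρ : ∀ i, 0 < ρ i) :
    -- a full-order controller is feasible iff the LMIs hold for some Lyapunov matrix
    (∀ (Γ : Fin nu → ℝ) (K : SparseH2.Controller nx nu ny),
      SparseH2.DesignFeasible P K γ₀ Γ ↔
        ∃ (Xcl : Matrix (Fin nx ⊕ Fin nx) (Fin nx ⊕ Fin nx) ℝ)
          (Q : Matrix (Fin nz) (Fin nz) ℝ),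
          SparseH2.Pos Xcl ∧
            SparseH2.LMIFeasible P (SparseH2.transformVars P K Xcl Q) γ₀ Γ) ∧
    -- every solution of the LMIs in the transformed variables yields feasible controllers
    (∀ (Γ : Fin nu → ℝ) (V : SparseH2.LMIVars nx nu nz ny),
      SparseH2.LMIFeasible P V γ₀ Γ →
        (∃ M N : Matrix (Fin nx) (Fin nx) ℝ,
          IsUnit M ∧ IsUnit N ∧ M * Nᵀ = 1 - V.X * V.Y) ∧
        ∀ M N : Matrix (Fin nx) (Fin nx) ℝ,
          IsUnit M → IsUnit N → M * Nᵀ = 1 - V.X * V.Y →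
            SparseH2.DesignFeasible P (SparseH2.reconstruct P V M N) γ₀ Γ) ∧
    -- every feasible controller is obtained in this way
    (∀ (Γ : Fin nu → ℝ) (K : SparseH2.Controller nx nu ny),
      SparseH2.DesignFeasible P K γ₀ Γ →
        ∃ (V : SparseH2.LMIVars nx nu nz ny) (M N : Matrix (Fin nx) (Fin nx) ℝ),
          SparseH2.LMIFeasible P V γ₀ Γ ∧ IsUnit M ∧ IsUnit N ∧
            M * Nᵀ = 1 - V.X * V.Y ∧ K = SparseH2.reconstruct P V M N) ∧
    -- the two optimization problems have the same optimal value
    SparseH2.designValue P γ₀ ρ = SparseH2.lmiValue P γ₀ ρ := by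
  refine ⟨fun Γ K => ⟨fun h => h.exists_lmiFeasible hγ₀, ?_⟩, fun Γ V h =>
    ⟨h.exists_factorization, fun M N hM hN hMN => h.designFeasible_reconstruct hγ₀ hM hN hMN⟩,
    fun Γ K h => ?_, ?_⟩
  · rintro ⟨𝒳, Q, h𝒳, h⟩
    exact h.designFeasible hγ₀ h𝒳
  · obtain ⟨𝒳, Q, h𝒳, hV⟩ := h.exists_lmiFeasible hγ₀
    obtain ⟨hM, hN⟩ := hV.isUnit_toBlocks₁₂ h𝒳
    exact ⟨_, _, _, hV, hM, hN, SparseH2.toBlocks₁₂_mul_transpose h𝒳,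
      (SparseH2.reconstruct_transformVars P K hM hN Q).symm⟩
  · unfold SparseH2.designValue SparseH2.lmiValue
    congr 1
    ext c
    constructor
    · rintro ⟨Γ, K, h, rfl⟩
      obtain ⟨𝒳, Q, -, hV⟩ := h.exists_lmiFeasible hγ₀
      exact ⟨Γ, _, hV, rfl⟩
    · rintro ⟨Γ, V, h, rfl⟩
      obtain ⟨M, N, hM, hN, hMN⟩ := h.exists_factorization
      exact ⟨Γ, _, h.designFeasible_reconstruct hγ₀ hM hN hMN, rfl⟩
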